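/- Let $\mathcal A$ be a finite-dimensional Hopf algebra with invertible antipode $S$ over a field $K$, and let $\mathcal A^\circ$ be its dual with the convolution product $\langle\lambda\mu,a\rangle=\langle\lambda\otimes\mu,\Delta(a)\rangle$, the opposite comultiplication $\langle\Delta\lambda,a\otimes b\rangle=\langle\lambda,ba\rangle$ and the antipode $\lambda\mapsto\lambda\circ S^{-1}$. Let $D(\mathcal A)$ be the Drinfeld double: the Hopf algebra which contains $\mathcal A$ and $\mathcal A^\circ$ as sub-Hopf algebras, in which $\mathcal A^\circ\otimes\mathcal A\to D(\mathcal A)$, $\lambda\otimes a\mapsto\lambda a$, is an isomorphism, and in which $a\lambda=\sum\langle\lambda',a'\rangle\langle S(\lambda'''),a'''\rangle\,\lambda''a''$ (in Sweedler notation). Let $R=\sum_i e_i\otimes f_i$ be its canonical $R$-matrix, for dual bases $e_i$ of $\mathcal A$ and $f_i$ of $\mathcal A^\circ$, and put $u=\sum_i S(f_i)e_i$, $\hat u=\sum_i S^2(e_i)f_i$ and $g=u\hat u$. A balancing of $D(\mathcal A)$ is a group-like element $k\in D(\mathcal A)$ such that $g=k^2$ and $S^2(y)=kyk^{-1}$ for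 all $y\in D(\mathcal A)$. The modulus $\alpha\in\mathcal A^\circ$ and the comodulus $a\in\mathcal A$ are given by $xh=\alpha(h)x$ and $(\mu\otimes 1)\Delta(h)=\mu(h)a$ for all $h\in\mathcal A$, where $x\ne0$ is a left cointegral ($hx=\epsilon(h)x$) and $\mu\ne0$ is a left integral ($(1\otimes\mu)\Delta(h)=\mu(h)1$). Put $\omega=\alpha(a)$, and let $\chi:D(\mathcal A)\to K$ be the linear form with $\chi(\lambda y)=\lambda(y)$ for $\lambda\in\mathcal A^\circ$, $y\in\mathcal A$. 1. An element $k\in D(\mathcal A)$ is a balancing of $D(\mathcal A)$ if and only if $k=\sqrt\alpha\,(\sqrt a)^{-1}$ for some group-like elements $\sqrt\alpha$ of $\mathcal A^\circ$ and $\sqrt a$ of $\mathcal A$ with $(\sqrt\alpha)^2=\alpha$, $(\sqrt a)^2=a$ and $$S^2=ad^*(\sqrt\alpha)\circ ad\bigl((\sqrt a)^{-1}\bigr)\quad\text{on }\mathcal A .$$ Here $ad(b)(y)=\sum b'\,y\,S(b'')$ and $ad^*(\gamma)(y)=\sum\gamma^{-1}(y')\,y''\,\gamma(y''')$ for group-like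 $\gamma\in\mathcal A^\circ$. 2. To a balancing $k$ associate the number $\nu$ defined by $\nu^{-1}=\chi(k)$. If $k=\sqrt\alpha\,(\sqrt a)^{-1}$ with $\sqrt\alpha,\sqrt a$ group-like, then $\nu^{-1}=\chi(k)=\bigl(\sqrt\alpha(\sqrt a)\bigr)^{-1}$, that is, $\nu=\sqrt\alpha(\sqrt a)$. If $D(\mathcal A)$ admits a balancing, then $\nu$ is a root of unity, $\nu^4=\omega$, and $\nu^2$ does not depend on the choice of the balancing. -/

import Mathlib

open scoped TensorProduct
open Coalgebra HopfAlgebra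

/-- The antipode of the Hopf algebra `A` is invertible. -/
class InvertibleAntipode (K A : Type*) [Field K] [Ring A] [HopfAlgebra K A] : Prop where
  bijective : Function.Bijective (antipode K : A →ₗ[K] A)

noncomputable section

section AntipodeInv

variable (K : Type*) {A : Type*} [Field K] [Ring A] [HopfAlgebra K A]

/-- Anti-comultiplicativity of the antipode. -/
theorem comul_antipode_eq (a : A) :
    comul (R := K) (antipode K a) =
      TensorProduct.map (antipode K) (antipode K) (TensorProduct.comm K A A (comul a)) := by
  have key : (comul ∘ₗ antipode K : A →ₗ[K] A ⊗[K] A) =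
      TensorProduct.map (antipode K) (antipode K) ∘ₗ (TensorProduct.comm K A A).toLinearMap ∘ₗ
        comul := by
    apply WithConv.toConv_injective
    symm
    apply left_inv_eq_right_inv (a := WithConv.toConv (comul : A →ₗ[K] A ⊗[K] A))
    · ext a
      -- the four-fold coproduct `a₁ ⊗ (a₂ ⊗ a₃) ⊗ a₄` contracted by the antipode
      let V : A ⊗[K] ((A ⊗[K] A) ⊗[K] A) →ₗ[K] A ⊗[K] A :=
        LinearMap.mul' K (A ⊗[K] A) ∘ₗ
          TensorProduct.map
            (TensorProduct.map (antipode K) (antipode K) ∘ₗ (TensorProduct.comm K A A).toLinearMap)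
            LinearMap.id ∘ₗ
          (TensorProduct.assoc K A A (A ⊗[K] A)).symm.toLinearMap ∘ₗ
          LinearMap.lTensor A (TensorProduct.assoc K A A A).toLinearMap
      have h1 : (LinearMap.mul' K (A ⊗[K] A) ∘ₗ TensorProduct.map
            (TensorProduct.map (antipode K) (antipode K) ∘ₗ (TensorProduct.comm K A A).toLinearMap
              ∘ₗ comul) comul) ∘ₗ comul =
          V ∘ₗ (LinearMap.lTensor A (LinearMap.rTensor A comul)) ∘ₗ
            (LinearMap.lTensor A comul) ∘ₗ comul := by
        simp only [V, coassoc_simps]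
      have h2 : ∀ p u v : A, V (p ⊗ₜ (comul (R := K) u ⊗ₜ v)) =
          counit (R := K) u • (1 ⊗ₜ (antipode K p * v)) := by
        intro p u v
        have h3 : ∀ t : A ⊗[K] A, V (p ⊗ₜ (t ⊗ₜ v)) =
            LinearMap.mul' K A (LinearMap.rTensor A (antipode K) t) ⊗ₜ (antipode K p * v) := by
          intro t
          induction t with
          | zero => simp
          | add x y hx hy => simp only [TensorProduct.add_tmul, TensorProduct.tmul_add, map_add, hx, hy]
          | tmul x y => simp [V]
        rw [h3, mul_antipode_rTensor_comul_apply, Algebra.algebraMap_eq_smul_one,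
          TensorProduct.smul_tmul']
      have h4 : ∀ p z : A, V (p ⊗ₜ (LinearMap.rTensor A comul (comul (R := K) z))) =
          1 ⊗ₜ (antipode K p * z) := by
        intro p z
        have h5 : ∀ t : A ⊗[K] A, V (p ⊗ₜ (LinearMap.rTensor A comul t)) =
            1 ⊗ₜ (antipode K p * TensorProduct.lid K A (LinearMap.rTensor A counit t)) := by
          intro t
          induction t with
          | zero => simp
          | add x y hx hy => simp only [TensorProduct.tmul_add, map_add, hx, hy, mul_add]
          | tmul x y => simp [h2]
        rw [h5]
        simp
      have h6 : ∀ t : A ⊗[K] A, V (LinearMap.lTensor A (LinearMap.rTensor A comul)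
          (LinearMap.lTensor A comul t)) =
          1 ⊗ₜ LinearMap.mul' K A (LinearMap.rTensor A (antipode K) t) := by
        intro t
        induction t with
        | zero => simp
        | add x y hx hy => simp only [TensorProduct.tmul_add, map_add, hx, hy]
        | tmul x y => simp [h4]
      have h7 := h6 (comul a)
      rw [mul_antipode_rTensor_comul_apply] at h7
      refine (congr($h1 a)).trans (h7.trans ?_)
      simp [Algebra.algebraMap_eq_smul_one, Algebra.TensorProduct.one_def]
    · exact LinearMap.comul_right_inv
  exact congr($key a)

variable [h : InvertibleAntipode K A]

variable (A) in
/-- The inverse of the antipode. -/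
def antipodeInv : A →ₗ[K] A :=
  (LinearEquiv.ofBijective (antipode K : A →ₗ[K] A) h.bijective).symm.toLinearMap

@[simp] theorem antipode_antipodeInv (a : A) : antipode K (antipodeInv K A a) = a :=
  LinearEquiv.apply_symm_apply (LinearEquiv.ofBijective (antipode K : A →ₗ[K] A) h.bijective) a

@[simp] theorem antipodeInv_antipode (a : A) : antipodeInv K A (antipode K a) = a :=
  LinearEquiv.symm_apply_apply (LinearEquiv.ofBijective (antipode K : A →ₗ[K] A) h.bijective) a

theorem antipodeInv_mul (a b : A) :
    antipodeInv K A (a * b) = antipodeInv K A b * antipodeInv K A a := by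
  apply h.bijective.1
  simp [antipode_mul_antidistrib]

@[simp] theorem antipodeInv_one : antipodeInv K A (1 : A) = 1 := by
  apply h.bijective.1
  simp

@[simp] theorem counit_antipodeInv (a : A) :
    counit (R := K) (antipodeInv K A a) = counit (R := K) a := by
  rw [← counit_antipode, antipode_antipodeInv]

theorem comul_antipodeInv (a : A) :
    comul (R := K) (antipodeInv K A a) = TensorProduct.map (antipodeInv K A) (antipodeInv K A)
        (TensorProduct.comm K A A (comul a)) := by
  obtain ⟨b, rfl⟩ := h.bijective.2 a
  rw [comul_antipode_eq, antipodeInv_antipode]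
  generalize comul (R := K) b = t
  induction t with
  | zero => simp
  | add x y hx hy => simp only [map_add]; rw [← hx, ← hy]
  | tmul x y => simp

/-- `∑ a₂ S⁻¹(a₁) = ε(a) 1`. -/
theorem mul_antipodeInv_left (a : A) :
    LinearMap.mul' K A (TensorProduct.comm K A A
      (LinearMap.rTensor A (antipodeInv K A) (comul a))) = counit (R := K) a • 1 := by
  apply h.bijective.1
  have h1 : ∀ t : A ⊗[K] A, antipode K (LinearMap.mul' K A (TensorProduct.comm K A A
      (LinearMap.rTensor A (antipodeInv K A) t))) =
      LinearMap.mul' K A (LinearMap.lTensor A (antipode K) t) := by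
    intro t
    induction t with
    | zero => simp
    | add x y hx hy => simp only [map_add, hx, hy]
    | tmul x y => simp [antipode_mul_antidistrib]
  rw [h1, mul_antipode_lTensor_comul_apply]
  simp [Algebra.algebraMap_eq_smul_one]

/-- `∑ S⁻¹(a₂) a₁ = ε(a) 1`. -/
theorem mul_antipodeInv_right (a : A) :
    LinearMap.mul' K A (TensorProduct.comm K A A
      (LinearMap.lTensor A (antipodeInv K A) (comul a))) = counit (R := K) a • 1 := by
  apply h.bijective.1
  have h1 : ∀ t : A ⊗[K] A, antipode K (LinearMap.mul' K A (TensorProduct.comm K A A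
      (LinearMap.lTensor A (antipodeInv K A) t))) =
      LinearMap.mul' K A (LinearMap.rTensor A (antipode K) t) := by
    intro t
    induction t with
    | zero => simp
    | add x y hx hy => simp only [map_add, hx, hy]
    | tmul x y => simp [antipode_mul_antidistrib]
  rw [h1, mul_antipode_rTensor_comul_apply]
  simp [Algebra.algebraMap_eq_smul_one]

end AntipodeInv

section OpDual

variable (K A : Type*) [Field K] [Ring A] [HopfAlgebra K A]

/-- The dual `A°` of `A` : the linear forms on `A` with the convolution product
`⟨λ μ, a⟩ = ⟨λ ⊗ μ, Δ a⟩`. Below it gets the comultiplication *opposite* to the dual of the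
product, `⟨Δ λ, a ⊗ b⟩ = ⟨λ, b a⟩`, and the antipode `λ ↦ λ ∘ S⁻¹`. -/
def OpDual : Type _ := WithConv (A →ₗ[K] K)

namespace OpDual

instance : Ring (OpDual K A) := inferInstanceAs (Ring (WithConv (A →ₗ[K] K)))

instance : Algebra K (OpDual K A) := inferInstanceAs (Algebra K (WithConv (A →ₗ[K] K)))

/-- The identification of `A°` with the space of linear forms on `A`. -/
def toDual : OpDual K A ≃ₗ[K] Module.Dual K A := WithConv.linearEquiv K (A →ₗ[K] K)

variable {K A}

instance : FunLike (OpDual K A) A K where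
  coe f := toDual K A f
  coe_injective f g h := (toDual K A).injective (DFunLike.coe_injective h)

instance : LinearMapClass (OpDual K A) K A K where
  map_add f := map_add (toDual K A f)
  map_smulₛₗ f := map_smul (toDual K A f)

@[ext] theorem ext {f g : OpDual K A} (h : ∀ a, f a = g a) : f = g := DFunLike.ext _ _ h

@[simp] theorem toDual_apply (f : OpDual K A) (a : A) : toDual K A f a = f a := rfl

@[simp] theorem toDual_symm_apply (f : Module.Dual K A) (a : A) :
    (toDual K A).symm f a = f a := rfl

@[simp] theorem add_apply (f g : OpDual K A) (a : A) : (f + g) a = f a + g a := rfl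

@[simp] theorem zero_apply (a : A) : (0 : OpDual K A) a = 0 := rfl

@[simp] theorem smul_apply (c : K) (f : OpDual K A) (a : A) : (c • f) a = c * f a := rfl

/-- The pairing of `A° ⊗ A°` with `A ⊗ A`. -/
def pair : OpDual K A ⊗[K] OpDual K A →ₗ[K] Module.Dual K (A ⊗[K] A) :=
  TensorProduct.dualDistrib K A A ∘ₗ
    TensorProduct.map (toDual K A).toLinearMap (toDual K A).toLinearMap

@[simp] theorem pair_tmul (f g : OpDual K A) (a b : A) :
    pair (f ⊗ₜ g) (a ⊗ₜ b) = f a * g b := rfl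

theorem one_apply (a : A) : (1 : OpDual K A) a = counit (R := K) a := rfl

theorem mul_apply (f g : OpDual K A) (a : A) : (f * g) a = pair (f ⊗ₜ g) (comul a) := by
  change LinearMap.mul' K K (TensorProduct.map (toDual K A f) (toDual K A g) (comul a)) = _
  generalize comul (R := K) a = t
  induction t with
  | zero => simp
  | add x y hx hy => simp only [map_add, hx, hy]
  | tmul x y => simp

/-- Evaluation of the first tensor factor. -/
def evL (M : Type*) [AddCommGroup M] [Module K M] (a : A) : OpDual K A ⊗[K] M →ₗ[K] M :=
  (LinearMap.applyₗ a) ∘ₗ dualTensorHom K A M ∘ₗ LinearMap.rTensor M (toDual K A).toLinearMap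

@[simp] theorem evL_tmul {M : Type*} [AddCommGroup M] [Module K M] (a : A) (f : OpDual K A)
    (m : M) : evL M a (f ⊗ₜ m) = f a • m := rfl

theorem pair_eq_evL (t : OpDual K A ⊗[K] OpDual K A) (a b : A) :
    pair t (a ⊗ₜ b) = evL (OpDual K A) a t b := by
  induction t with
  | zero => simp
  | add x y hx hy => simp only [map_add, LinearMap.add_apply, hx, hy, add_apply]
  | tmul x y => simp

theorem pair_mul (t s : OpDual K A ⊗[K] OpDual K A) (a b : A) :
    pair (t * s) (a ⊗ₜ b) = TensorProduct.lift (LinearMap.mul K K) (TensorProduct.map (pair t) (pair s)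
      (TensorProduct.tensorTensorTensorComm K A A A A (comul a ⊗ₜ comul b))) := by
  induction t with
  | zero => simp
  | add x y hx hy =>
    simp only [add_mul, map_add, LinearMap.add_apply, hx, hy, TensorProduct.map_add_left]
  | tmul x y =>
  induction s with
  | zero => simp
  | add x y hx hy =>
    simp only [mul_add, map_add, LinearMap.add_apply, hx, hy, TensorProduct.map_add_right]
  | tmul z w =>
    rw [Algebra.TensorProduct.tmul_mul_tmul, pair_tmul, mul_apply, mul_apply]
    generalize comul (R := K) a = p
    generalize comul (R := K) b = q
    induction p with
    | zero => simp
    | add x y hx hy => simp only [TensorProduct.add_tmul, map_add, add_mul, hx, hy]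
    | tmul a1 a2 =>
    induction q with
    | zero => simp
    | add x y hx hy => simp only [TensorProduct.tmul_add, map_add, mul_add, hx, hy]
    | tmul b1 b2 => simp; ring

variable [FiniteDimensional K A]

theorem ext_evL {M : Type*} [AddCommGroup M] [Module K M] {t s : OpDual K A ⊗[K] M}
    (h : ∀ a, evL M a t = evL M a s) : t = s := by
  apply ((toDual K A).rTensor M).injective
  apply (dualTensorHomEquiv K A M).injective
  ext a
  have := h a
  exact this

theorem ext_pair {t s : OpDual K A ⊗[K] OpDual K A}
    (h : ∀ a b, pair t (a ⊗ₜ b) = pair s (a ⊗ₜ b)) : t = s := by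
  refine ext_evL fun a => ext fun b => ?_
  simpa [pair_eq_evL] using h a b

variable (K A) in
theorem pair_bijective : Function.Bijective (pair (K := K) (A := A)) :=
  ((TensorProduct.congr (toDual K A) (toDual K A)).trans
    (TensorProduct.dualDistribEquiv K A A)).bijective

/-- `⟨Δ λ, a ⊗ b⟩ = ⟨λ, b a⟩` and `ε(λ) = λ(1)`. -/
instance : CoalgebraStruct K (OpDual K A) where
  comul := (LinearEquiv.ofBijective pair (pair_bijective K A)).symm.toLinearMap ∘ₗ
    (LinearMap.mul' K A ∘ₗ (TensorProduct.comm K A A).toLinearMap).dualMap ∘ₗ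
    (toDual K A).toLinearMap
  counit := LinearMap.applyₗ (1 : A) ∘ₗ (toDual K A).toLinearMap

theorem pair_comul (f : OpDual K A) (t : A ⊗[K] A) :
    pair (comul (R := K) f) t = f (LinearMap.mul' K A (TensorProduct.comm K A A t)) := by
  have := LinearEquiv.apply_symm_apply (LinearEquiv.ofBijective pair (pair_bijective K A))
    ((LinearMap.mul' K A ∘ₗ (TensorProduct.comm K A A).toLinearMap).dualMap (toDual K A f))
  exact congr($this t)

@[simp] theorem pair_comul_tmul (f : OpDual K A) (a b : A) :
    pair (comul (R := K) f) (a ⊗ₜ b) = f (b * a) := by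
  simp [pair_comul]

theorem evL_comul (f : OpDual K A) (a b : A) :
    evL (OpDual K A) a (comul (R := K) f) b = f (b * a) := by
  rw [← pair_eq_evL, pair_comul_tmul]

@[simp] theorem counit_apply (f : OpDual K A) : counit (R := K) f = f 1 := rfl

instance : Coalgebra K (OpDual K A) where
  coassoc := by
    ext f : 1
    refine ext_evL fun a => ext_evL fun b => ext fun c => ?_
    have h1 : ∀ t : OpDual K A ⊗[K] OpDual K A,
        evL _ b (evL _ a (TensorProduct.assoc K _ _ _ (LinearMap.rTensor (OpDual K A) comul t))) =
          evL _ (b * a) t := by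
      intro t
      induction t with
      | zero => simp
      | add x y hx hy => simp only [map_add, hx, hy]
      | tmul x y =>
        rw [LinearMap.rTensor_tmul, evL_tmul, ← pair_comul_tmul x a b]
        generalize comul (R := K) x = s
        induction s with
        | zero => simp
        | add x y hx hy =>
          simp only [TensorProduct.add_tmul, map_add, hx, hy, LinearMap.add_apply, add_smul]
        | tmul x y => simp [mul_smul]
    have h2 : ∀ t : OpDual K A ⊗[K] OpDual K A,
        evL _ b (evL _ a (LinearMap.lTensor (OpDual K A) comul t)) c = evL _ a t (c * b) := by
      intro t
      induction t with
      | zero => simp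
      | add x y hx hy => simp only [map_add, hx, hy, add_apply]
      | tmul x y => simp [evL_comul]
    simp only [LinearMap.comp_apply, LinearEquiv.coe_coe]
    rw [h1, h2, evL_comul, evL_comul, mul_assoc]
  rTensor_counit_comp_comul := by
    ext f : 1
    apply (TensorProduct.lid K (OpDual K A)).injective
    have h1 : ∀ t : OpDual K A ⊗[K] OpDual K A,
        TensorProduct.lid K _ (LinearMap.rTensor (OpDual K A) counit t) = evL _ 1 t := by
      intro t
      induction t with
      | zero => simp
      | add x y hx hy => simp only [map_add, hx, hy]
      | tmul x y => simp
    ext a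
    simp [h1, evL_comul]
  lTensor_counit_comp_comul := by
    ext f : 1
    apply (TensorProduct.rid K (OpDual K A)).injective
    have h1 : ∀ (a : A) (t : OpDual K A ⊗[K] OpDual K A),
        TensorProduct.rid K _ (LinearMap.lTensor (OpDual K A) counit t) a = evL _ a t 1 := by
      intro a t
      induction t with
      | zero => simp
      | add x y hx hy => simp only [map_add, hx, hy, add_apply]
      | tmul x y => simp [mul_comm]
    ext a
    simp [h1, evL_comul]

instance : Bialgebra K (OpDual K A) :=
  Bialgebra.mk' K (OpDual K A)
    (by simp [one_apply])
    (by intro f g; simp [mul_apply, Algebra.TensorProduct.one_def])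
    (by
      refine ext_pair fun a b => ?_
      simp [one_apply, Algebra.TensorProduct.one_def, mul_comm])
    (by
      intro f g
      refine ext_pair fun a b => ?_
      rw [pair_mul, pair_comul_tmul, mul_apply, Bialgebra.comul_mul]
      generalize comul (R := K) a = p
      generalize comul (R := K) b = q
      induction p with
      | zero => simp
      | add x y hx hy => simp only [TensorProduct.add_tmul, map_add, mul_add, hx, hy]
      | tmul a1 a2 =>
      induction q with
      | zero => simp
      | add x y hx hy => simp only [TensorProduct.tmul_add, map_add, add_mul, hx, hy]
      | tmul b1 b2 => simp)

variable [InvertibleAntipode K A]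

/-- The antipode of `A°` is `λ ↦ λ ∘ S⁻¹`. -/
instance : HopfAlgebra K (OpDual K A) where
  antipode := (toDual K A).symm.toLinearMap ∘ₗ (antipodeInv K A).dualMap ∘ₗ
    (toDual K A).toLinearMap
  mul_antipode_rTensor_comul := by
    ext f a
    have h1 : ∀ (t : OpDual K A ⊗[K] OpDual K A), LinearMap.mul' K (OpDual K A)
        (LinearMap.rTensor (OpDual K A) ((toDual K A).symm.toLinearMap ∘ₗ
          (antipodeInv K A).dualMap ∘ₗ (toDual K A).toLinearMap) t) a =
        pair t (LinearMap.rTensor A (antipodeInv K A) (comul a)) := by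
      intro t
      induction t with
      | zero => simp
      | add x y hx hy => simp only [map_add, add_apply, LinearMap.add_apply, hx, hy]
      | tmul x y =>
        simp only [LinearMap.rTensor_tmul, LinearMap.mul'_apply, mul_apply]
        generalize comul (R := K) a = s
        induction s with
        | zero => simp
        | add x y hx hy => simp only [map_add, hx, hy]
        | tmul x y => simp
    simp only [LinearMap.comp_apply (f := LinearMap.mul' K (OpDual K A)), LinearMap.comp_apply (g := comul)]
    rw [h1, pair_comul, mul_antipodeInv_left]
    simp [Algebra.algebraMap_eq_smul_one, one_apply, mul_comm]
  mul_antipode_lTensor_comul := by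
    ext f a
    have h1 : ∀ (t : OpDual K A ⊗[K] OpDual K A), LinearMap.mul' K (OpDual K A)
        (LinearMap.lTensor (OpDual K A) ((toDual K A).symm.toLinearMap ∘ₗ
          (antipodeInv K A).dualMap ∘ₗ (toDual K A).toLinearMap) t) a =
        pair t (LinearMap.lTensor A (antipodeInv K A) (comul a)) := by
      intro t
      induction t with
      | zero => simp
      | add x y hx hy => simp only [map_add, add_apply, LinearMap.add_apply, hx, hy]
      | tmul x y =>
        simp only [LinearMap.lTensor_tmul, LinearMap.mul'_apply, mul_apply]
        generalize comul (R := K) a = s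
        induction s with
        | zero => simp
        | add x y hx hy => simp only [map_add, hx, hy]
        | tmul x y => simp
    simp only [LinearMap.comp_apply (f := LinearMap.mul' K (OpDual K A)), LinearMap.comp_apply (g := comul)]
    rw [h1, pair_comul, mul_antipodeInv_right]
    simp [Algebra.algebraMap_eq_smul_one, one_apply, mul_comm]

@[simp] theorem antipode_apply (f : OpDual K A) (a : A) :
    antipode K f a = f (antipodeInv K A a) := rfl

end OpDual

end OpDual

section Bowtie

variable (K A : Type*) [Field K] [Ring A] [HopfAlgebra K A]

/-- The contraction `a ⊗ λ ↦ ⟨λ, a⟩`. -/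
def dualContraction : A ⊗[K] OpDual K A →ₗ[K] K :=
  contractRight K A ∘ₗ LinearMap.lTensor A (OpDual.toDual K A).toLinearMap

@[simp] theorem dualContraction_tmul (a : A) (f : OpDual K A) :
    dualContraction K A (a ⊗ₜ f) = f a := rfl

/-- The two-fold coproduct `c ↦ c₁ ⊗ (c₂ ⊗ c₃)`. -/
def comul₂ (C : Type*) [AddCommGroup C] [Module K C] [Coalgebra K C] :
    C →ₗ[K] C ⊗[K] (C ⊗[K] C) :=
  LinearMap.lTensor C comul ∘ₗ comul

variable [FiniteDimensional K A] [InvertibleAntipode K A]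

/-- The contraction
`(a₁ ⊗ (a₂ ⊗ a₃)) ⊗ (λ₁ ⊗ (λ₂ ⊗ λ₃)) ↦ ⟨λ₁, a₁⟩ ⟨S(λ₃), a₃⟩ λ₂ ⊗ a₂`. -/
def bowtieContraction :
    (A ⊗[K] (A ⊗[K] A)) ⊗[K] (OpDual K A ⊗[K] (OpDual K A ⊗[K] OpDual K A)) →ₗ[K]
      OpDual K A ⊗[K] A :=
  (TensorProduct.rid K (OpDual K A ⊗[K] A)).toLinearMap ∘ₗ
    (TensorProduct.lid K ((OpDual K A ⊗[K] A) ⊗[K] K)).toLinearMap ∘ₗ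
    TensorProduct.map (dualContraction K A)
      (TensorProduct.map (TensorProduct.comm K A (OpDual K A)).toLinearMap
        (dualContraction K A ∘ₗ LinearMap.lTensor A (antipode K))) ∘ₗ
    LinearMap.lTensor (A ⊗[K] OpDual K A)
      (TensorProduct.tensorTensorTensorComm K A A (OpDual K A) (OpDual K A)).toLinearMap ∘ₗ
    (TensorProduct.tensorTensorTensorComm K A (A ⊗[K] A) (OpDual K A)
      (OpDual K A ⊗[K] OpDual K A)).toLinearMap

theorem bowtieContraction_tmul (p q r : A) (f g h : OpDual K A) :
    bowtieContraction K A ((p ⊗ₜ (q ⊗ₜ r)) ⊗ₜ (f ⊗ₜ (g ⊗ₜ h))) =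
      (f p * antipode K h r) • (g ⊗ₜ q) := by
  simp [bowtieContraction, smul_smul]

/-- The bicrossed structure `a ⊗ λ ↦ ∑ ⟨λ₁, a₁⟩ ⟨S(λ₃), a₃⟩ λ₂ ⊗ a₂`, where the coproduct and the
antipode of `λ` are those of `A°`. -/
def bowtie : A ⊗[K] OpDual K A →ₗ[K] OpDual K A ⊗[K] A :=
  bowtieContraction K A ∘ₗ TensorProduct.map (comul₂ K A) (comul₂ K (OpDual K A))

/-- The bilinear product `(λ ⊗ a)(γ ⊗ b) = λ · ⋈(a ⊗ γ) · b` on `A° ⊗ A`. -/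
def bowtieMul : OpDual K A ⊗[K] A →ₗ[K] OpDual K A ⊗[K] A →ₗ[K] OpDual K A ⊗[K] A :=
  TensorProduct.curry
    (TensorProduct.map (LinearMap.mul' K (OpDual K A)) (LinearMap.mul' K A) ∘ₗ
      (TensorProduct.assoc K (OpDual K A) (OpDual K A) (A ⊗[K] A)).symm.toLinearMap ∘ₗ
      LinearMap.lTensor (OpDual K A)
        ((TensorProduct.assoc K (OpDual K A) A A).toLinearMap ∘ₗ
          LinearMap.rTensor A (bowtie K A) ∘ₗ
          (TensorProduct.assoc K A (OpDual K A) A).symm.toLinearMap) ∘ₗ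
      (TensorProduct.assoc K (OpDual K A) A (OpDual K A ⊗[K] A)).toLinearMap)

variable {K A}

namespace OpDual

theorem bowtieMul_tmul (f g : OpDual K A) (a b : A) :
    bowtieMul K A (f ⊗ₜ a) (g ⊗ₜ b) =
      TensorProduct.map (LinearMap.mulLeft K f) (LinearMap.mulRight K b) (bowtie K A (a ⊗ₜ g)) := by
  simp only [bowtieMul, TensorProduct.curry_apply, LinearMap.comp_apply, LinearEquiv.coe_coe,
    TensorProduct.assoc_tmul, LinearMap.lTensor_tmul, TensorProduct.assoc_symm_tmul,
    LinearMap.rTensor_tmul]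
  generalize bowtie K A (a ⊗ₜ g) = t
  induction t with
  | zero => simp
  | add x y hx hy => simp only [TensorProduct.add_tmul, TensorProduct.tmul_add, map_add, hx, hy]
  | tmul x y => simp

/-- `p ⊗ (q ⊗ r) ↦ (f ⊗ m ↦ f(S⁻¹(r) x p) q m)`. -/
def sand (x : A) : A ⊗[K] (A ⊗[K] A) →ₗ[K] OpDual K A ⊗[K] A →ₗ[K] A :=
  TensorProduct.curry
   (LinearMap.mul' K A ∘ₗ LinearMap.rTensor A
    (TensorProduct.rid K A ∘ₗ LinearMap.lTensor A
        (dualContraction K A ∘ₗ LinearMap.rTensor (OpDual K A)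
          (LinearMap.mul' K A ∘ₗ (TensorProduct.comm K A A).toLinearMap ∘ₗ
          TensorProduct.map (LinearMap.mulLeft K x) (antipodeInv K A))) ∘ₗ
       (TensorProduct.assoc K A (A ⊗[K] A) (OpDual K A)).toLinearMap ∘ₗ
       LinearMap.rTensor (OpDual K A) (TensorProduct.leftComm K A A A).toLinearMap) ∘ₗ
     (TensorProduct.assoc K (A ⊗[K] (A ⊗[K] A)) (OpDual K A) A).symm.toLinearMap)

@[simp] theorem sand_tmul (x p q r m : A) (f : OpDual K A) :
    sand x (p ⊗ₜ (q ⊗ₜ r)) (f ⊗ₜ m) = f (antipodeInv K A r * (x * p)) • (q * m) := by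
  simp [sand]

theorem evL_bowtie (x a : A) (f : OpDual K A) :
    evL A x (bowtie K A (a ⊗ₜ f)) = sand x (comul₂ K A a) (f ⊗ₜ 1) := by
  simp only [bowtie, LinearMap.comp_apply, TensorProduct.map_tmul]
  generalize comul₂ K A a = t
  induction t with
  | zero => simp
  | add x y hx hy => simp only [TensorProduct.add_tmul, map_add, LinearMap.add_apply, hx, hy]
  | tmul p t =>
  induction t with
  | zero => simp
  | add x y hx hy =>
    simp only [TensorProduct.add_tmul, TensorProduct.tmul_add, map_add, LinearMap.add_apply, hx, hy]
  | tmul q r =>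
  have h2 : ∀ s : OpDual K A ⊗[K] (OpDual K A ⊗[K] OpDual K A),
      evL A x (bowtieContraction K A ((p ⊗ₜ (q ⊗ₜ r)) ⊗ₜ s)) =
        (evL _ x (evL _ p s) (antipodeInv K A r)) • q := by
    intro s
    induction s with
    | zero => simp
    | add x y hx hy =>
      simp only [TensorProduct.tmul_add, map_add, add_apply, add_smul, hx, hy]
    | tmul f s =>
    induction s with
    | zero => simp
    | add x y hx hy =>
      simp only [TensorProduct.tmul_add, map_add, add_apply, add_smul, hx, hy]
    | tmul g h =>
      rw [bowtieContraction_tmul]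
      simp [smul_smul]
      congr 1
      ring
  rw [h2]
  have h3 : evL _ x (evL _ p (comul₂ K (OpDual K A) f)) (antipodeInv K A r) =
      f (antipodeInv K A r * (x * p)) := by
    have h4 : ∀ t : OpDual K A ⊗[K] OpDual K A, evL _ x (evL _ p (LinearMap.lTensor _ comul t))
        (antipodeInv K A r) = evL _ p t (antipodeInv K A r * x) := by
      intro t
      induction t with
      | zero => simp
      | add x y hx hy => simp only [map_add, hx, hy, add_apply]
      | tmul x y => simp [evL_comul]
    rw [comul₂, LinearMap.comp_apply, h4, evL_comul, mul_assoc]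
  rw [h3]
  simp

theorem evL_bowtieMul_right (x a : A) (t : OpDual K A ⊗[K] A) :
    evL A x (bowtieMul K A (1 ⊗ₜ a) t) = sand x (comul₂ K A a) t := by
  induction t with
  | zero => simp
  | add x y hx hy => simp only [map_add, hx, hy]
  | tmul f b =>
    rw [bowtieMul_tmul]
    have h1 : ∀ s : OpDual K A ⊗[K] A, evL A x (TensorProduct.map (LinearMap.mulLeft K 1)
        (LinearMap.mulRight K b) s) = evL A x s * b := by
      intro s
      induction s with
      | zero => simp
      | add x y hx hy => simp only [map_add, add_mul, hx, hy]
      | tmul f m => simp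
    rw [h1, evL_bowtie]
    generalize comul₂ K A a = t
    induction t with
    | zero => simp
    | add x y hx hy => simp only [map_add, LinearMap.add_apply, add_mul, hx, hy]
    | tmul p t =>
    induction t with
    | zero => simp
    | add x y hx hy =>
      simp only [TensorProduct.tmul_add, map_add, LinearMap.add_apply, add_mul, hx, hy]
    | tmul q r => simp

theorem comul₂_mul (a b : A) : comul₂ K A (a * b) = comul₂ K A a * comul₂ K A b := by
  simp only [comul₂, LinearMap.comp_apply, Bialgebra.comul_mul]
  exact map_mul (Algebra.TensorProduct.map (AlgHom.id K A) (Bialgebra.comulAlgHom K A)) _ _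

theorem bowtie_mul_left (a b : A) (f : OpDual K A) :
    bowtie K A ((a * b) ⊗ₜ f) = bowtieMul K A (1 ⊗ₜ a) (bowtie K A (b ⊗ₜ f)) := by
  refine ext_evL fun x => ?_
  rw [evL_bowtieMul_right, evL_bowtie, comul₂_mul]
  have h1 : ∀ (p q r : A) (t : OpDual K A ⊗[K] A), sand x (p ⊗ₜ (q ⊗ₜ r)) t =
      q * evL A (antipodeInv K A r * (x * p)) t := by
    intro p q r t
    induction t with
    | zero => simp
    | add x y hx hy => simp only [map_add, mul_add, hx, hy]
    | tmul f m => simp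
  generalize comul₂ K A a = t
  induction t with
  | zero => simp
  | add x y hx hy => simp only [map_add, LinearMap.add_apply, add_mul, hx, hy]
  | tmul p t =>
  induction t with
  | zero => simp
  | add x y hx hy =>
    simp only [TensorProduct.tmul_add, map_add, LinearMap.add_apply, add_mul, hx, hy]
  | tmul q r =>
  rw [h1, evL_bowtie]
  generalize comul₂ K A b = t
  induction t with
  | zero => simp
  | add x y hx hy => simp only [map_add, LinearMap.add_apply, mul_add, hx, hy]
  | tmul p' t =>
  induction t with
  | zero => simp
  | add x y hx hy =>
    simp only [TensorProduct.tmul_add, map_add, LinearMap.add_apply, mul_add, hx, hy]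
  | tmul q' r' => simp [antipodeInv_mul, mul_assoc]

/-- `p ⊗ (m ⊗ r) ↦ f(S⁻¹(r) x p) m`. -/
def sandM (M : Type*) [AddCommGroup M] [Module K M] (x : A) (f : OpDual K A) :
    A ⊗[K] (M ⊗[K] A) →ₗ[K] M :=
  (TensorProduct.rid K M).toLinearMap ∘ₗ LinearMap.lTensor M
      (toDual K A f ∘ₗ LinearMap.mul' K A ∘ₗ (TensorProduct.comm K A A).toLinearMap ∘ₗ
        TensorProduct.map (LinearMap.mulLeft K x) (antipodeInv K A)) ∘ₗ
    (TensorProduct.leftComm K A M A).toLinearMap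

section

variable {M N : Type*} [AddCommGroup M] [Module K M] [AddCommGroup N] [Module K N]

@[simp] theorem sandM_tmul (x : A) (f : OpDual K A) (p r : A) (m : M) :
    sandM M x f (p ⊗ₜ (m ⊗ₜ r)) = f (antipodeInv K A r * (x * p)) • m := by
  simp [sandM]

theorem map_sandM (L : M →ₗ[K] N) (x : A) (f : OpDual K A) (u : A ⊗[K] (M ⊗[K] A)) :
    L (sandM M x f u) = sandM N x f (LinearMap.lTensor A (LinearMap.rTensor A L) u) := by
  have : L ∘ₗ sandM M x f = sandM N x f ∘ₗ LinearMap.lTensor A (LinearMap.rTensor A L) := by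
    ext p m r; simp
  exact congr($this u)

end

theorem sand_eq_sandM (x : A) (f : OpDual K A) (u : A ⊗[K] (A ⊗[K] A)) :
    sand x u (f ⊗ₜ 1) = sandM A x f u := by
  have : (sand x).flip (f ⊗ₜ 1) = sandM A x f := by ext p q r; simp
  exact congr($this u)

theorem evL_bowtie_eq (x a : A) (f : OpDual K A) :
    evL A x (bowtie K A (a ⊗ₜ f)) = sandM A x f (comul₂ K A a) := by
  rw [evL_bowtie, sand_eq_sandM]

/-- The linear map attached to an element of `A° ⊗ M`. -/
def evLin (M : Type*) [AddCommGroup M] [Module K M] : OpDual K A ⊗[K] M →ₗ[K] A →ₗ[K] M :=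
  dualTensorHom K A M ∘ₗ LinearMap.rTensor M (toDual K A).toLinearMap

theorem evLin_apply (M : Type*) [AddCommGroup M] [Module K M] (t : OpDual K A ⊗[K] M) (x : A) :
    evLin M t x = evL M x t := rfl

theorem evL_map_mulLeft (x : A) (f : OpDual K A) (s : OpDual K A ⊗[K] A) :
    evL A x (TensorProduct.map (LinearMap.mulLeft K f) (LinearMap.mulRight K 1) s) =
      TensorProduct.lid K A (TensorProduct.map (toDual K A f) (evLin A s) (comul x)) := by
  induction s with
  | zero => simp
  | add x y hx hy => simp only [map_add, hx, hy, TensorProduct.map_add_right, LinearMap.add_apply]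
  | tmul g m =>
    simp only [TensorProduct.map_tmul, LinearMap.mulLeft_apply, evL_tmul, mul_apply]
    generalize comul (R := K) x = t
    induction t with
    | zero => simp
    | add x y hx hy => simp only [map_add, hx, hy, add_smul]
    | tmul y z => simp [evLin_apply, mul_smul, smul_comm (g z)]

/-- `w ⊗ x ↦ ev_x (w · g)`. -/
def bowtieEv (g : OpDual K A) : A ⊗[K] A →ₗ[K] A :=
  TensorProduct.lift (evLin A ∘ₗ bowtie K A ∘ₗ (TensorProduct.mk K A (OpDual K A)).flip g)

@[simp] theorem bowtieEv_tmul (g : OpDual K A) (w x : A) :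
    bowtieEv g (w ⊗ₜ x) = evL A x (bowtie K A (w ⊗ₜ g)) := rfl

theorem evL_bowtieMul_left (x : A) (t : OpDual K A ⊗[K] A) (g : OpDual K A) :
    evL A x (bowtieMul K A t (g ⊗ₜ 1)) =
      bowtieEv g (LinearMap.rTensor A (evLin A t) (comul x)) := by
  induction t with
  | zero => simp
  | add x y hx hy =>
    simp only [map_add, LinearMap.add_apply, hx, hy, LinearMap.rTensor_add]
  | tmul f w =>
    rw [bowtieMul_tmul, evL_map_mulLeft]
    generalize comul (R := K) x = t
    induction t with
    | zero => simp
    | add x y hx hy => simp only [map_add, hx, hy]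
    | tmul y z =>
      simp [evLin_apply, ← TensorProduct.smul_tmul']

theorem coassoc_aux :
    LinearMap.lTensor A (LinearMap.rTensor A (comul₂ K A)) ∘ₗ comul₂ K A =
      LinearMap.lTensor A (TensorProduct.assoc K A (A ⊗[K] A) A).symm.toLinearMap ∘ₗ
        LinearMap.lTensor A (LinearMap.lTensor A (TensorProduct.assoc K A A A).symm.toLinearMap) ∘ₗ
        (TensorProduct.assoc K A A (A ⊗[K] (A ⊗[K] A))).toLinearMap ∘ₗ
        TensorProduct.map comul (LinearMap.lTensor A comul) ∘ₗ comul₂ K A := by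
  simp only [comul₂, coassoc_simps]

theorem bowtie_mul_right (a : A) (f g : OpDual K A) :
    bowtie K A (a ⊗ₜ (f * g)) = bowtieMul K A (bowtie K A (a ⊗ₜ f)) (g ⊗ₜ 1) := by
  refine ext_evL fun x => ?_
  rw [evL_bowtieMul_left, evL_bowtie_eq, ← (ℛ K x).eq]
  simp only [map_sum, LinearMap.rTensor_tmul, bowtieEv_tmul, evLin_apply, evL_bowtie_eq, map_sandM]
  have h1 := congr($(coassoc_aux (K := K) (A := A)) a)
  simp only [LinearMap.comp_apply] at h1
  rw [h1]
  generalize comul₂ K A a = u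
  induction u with
  | zero => simp
  | add x y hx hy => simp only [map_add, hx, hy, Finset.sum_add_distrib]
  | tmul p u =>
  induction u with
  | zero => simp
  | add x y hx hy => simp only [TensorProduct.tmul_add, map_add, hx, hy, Finset.sum_add_distrib]
  | tmul q r =>
  rw [sandM_tmul, mul_apply, Bialgebra.comul_mul, Bialgebra.comul_mul, comul_antipodeInv,
    TensorProduct.map_tmul, LinearMap.lTensor_tmul, ← (ℛ K x).eq]
  generalize comul (R := K) p = P
  generalize comul (R := K) r = R
  induction P with
  | zero => simp
  | add x y hx hy =>
    simp only [TensorProduct.add_tmul, map_add, mul_add, add_smul, hx, hy, Finset.sum_add_distrib]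
  | tmul p p' =>
  induction R with
  | zero => simp
  | add x y hx hy =>
    simp only [TensorProduct.tmul_add, map_add, add_mul, add_smul, hx, hy, Finset.sum_add_distrib]
  | tmul r r' => simp [Finset.sum_mul, Finset.mul_sum, Finset.sum_smul, smul_smul, mul_comm]

theorem bowtie_one_left (f : OpDual K A) : bowtie K A (1 ⊗ₜ f) = f ⊗ₜ 1 := by
  refine ext_evL fun x => ?_
  simp [evL_bowtie_eq, comul₂, Algebra.TensorProduct.one_def]

theorem bowtie_one_right (a : A) : bowtie K A (a ⊗ₜ 1) = 1 ⊗ₜ a := by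
  refine ext_evL fun x => ?_
  rw [evL_bowtie_eq, evL_tmul, comul₂, LinearMap.comp_apply]
  have h1 : ∀ t : A ⊗[K] A, sandM A x 1 (LinearMap.lTensor A comul t) =
      counit (R := K) x • TensorProduct.lid K A (LinearMap.rTensor A counit t) := by
    intro t
    induction t with
    | zero => simp
    | add x y hx hy => simp only [map_add, smul_add, hx, hy]
    | tmul p s =>
      have h2 : ∀ t : A ⊗[K] A, sandM A x 1 (p ⊗ₜ t) = (counit (R := K) x * counit (R := K) p) •
          TensorProduct.rid K A (LinearMap.lTensor A counit t) := by
        intro t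
        induction t with
        | zero => simp
        | add x y hx hy => simp only [TensorProduct.tmul_add, map_add, smul_add, hx, hy]
        | tmul q r => simp [one_apply, smul_smul]; congr 1; ring
      simp [h2, smul_smul]
  rw [h1]
  simp [one_apply]

theorem bowtieMul_mulLeft (f : OpDual K A) (x y : OpDual K A ⊗[K] A) :
    bowtieMul K A (LinearMap.rTensor A (LinearMap.mulLeft K f) x) y =
      LinearMap.rTensor A (LinearMap.mulLeft K f) (bowtieMul K A x y) := by
  induction x with
  | zero => simp
  | add x y hx hy => simp only [map_add, LinearMap.add_apply, hx, hy]
  | tmul g a =>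
  induction y with
  | zero => simp
  | add x y hx hy => simp only [map_add, hx, hy]
  | tmul h b =>
  simp only [LinearMap.rTensor_tmul, bowtieMul_tmul, LinearMap.mulLeft_apply]
  generalize bowtie K A (a ⊗ₜ h) = t
  induction t with
  | zero => simp
  | add x y hx hy => simp only [map_add, hx, hy]
  | tmul k c => simp [mul_assoc]

theorem bowtieMul_mulRight (b : A) (x y : OpDual K A ⊗[K] A) :
    bowtieMul K A x (LinearMap.lTensor (OpDual K A) (LinearMap.mulRight K b) y) =
      LinearMap.lTensor (OpDual K A) (LinearMap.mulRight K b) (bowtieMul K A x y) := by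
  induction x with
  | zero => simp
  | add x y hx hy => simp only [map_add, LinearMap.add_apply, hx, hy]
  | tmul g a =>
  induction y with
  | zero => simp
  | add x y hx hy => simp only [map_add, hx, hy]
  | tmul h b =>
  simp only [LinearMap.lTensor_tmul, bowtieMul_tmul, LinearMap.mulRight_apply]
  generalize bowtie K A (a ⊗ₜ h) = t
  induction t with
  | zero => simp
  | add x y hx hy => simp only [map_add, hx, hy]
  | tmul k c => simp

theorem bowtieMul_one_left (x : OpDual K A ⊗[K] A) : bowtieMul K A (1 ⊗ₜ 1) x = x := by
  induction x with
  | zero => simp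
  | add x y hx hy => simp only [map_add, hx, hy]
  | tmul g a => simp [bowtieMul_tmul, bowtie_one_left]

theorem bowtieMul_one_right (x : OpDual K A ⊗[K] A) : bowtieMul K A x (1 ⊗ₜ 1) = x := by
  induction x with
  | zero => simp
  | add x y hx hy => simp only [map_add, LinearMap.add_apply, hx, hy]
  | tmul g a => simp [bowtieMul_tmul, bowtie_one_right]

theorem bowtieMul_aux_left (b : A) (g : OpDual K A) (t : OpDual K A ⊗[K] A) :
    bowtieMul K A (LinearMap.lTensor (OpDual K A) (LinearMap.mulRight K b) t) (g ⊗ₜ 1) =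
      bowtieMul K A t (bowtie K A (b ⊗ₜ g)) := by
  induction t with
  | zero => simp
  | add x y hx hy => simp only [map_add, LinearMap.add_apply, hx, hy]
  | tmul f w =>
    have h1 : ∀ s : OpDual K A ⊗[K] A, bowtieMul K A (f ⊗ₜ w) s =
        LinearMap.rTensor A (LinearMap.mulLeft K f) (bowtieMul K A (1 ⊗ₜ w) s) := by
      intro s
      rw [← bowtieMul_mulLeft]; simp
    rw [h1, ← bowtie_mul_left, LinearMap.lTensor_tmul, bowtieMul_tmul]
    simp [LinearMap.rTensor]

theorem bowtieMul_aux_right (a : A) (f : OpDual K A) (s : OpDual K A ⊗[K] A) :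
    bowtieMul K A (1 ⊗ₜ a) (LinearMap.rTensor A (LinearMap.mulLeft K f) s) =
      bowtieMul K A (bowtie K A (a ⊗ₜ f)) s := by
  induction s with
  | zero => simp
  | add x y hx hy => simp only [map_add, hx, hy]
  | tmul g v =>
    have h1 : ∀ t : OpDual K A ⊗[K] A, bowtieMul K A t (g ⊗ₜ v) =
        LinearMap.lTensor _ (LinearMap.mulRight K v) (bowtieMul K A t (g ⊗ₜ 1)) := by
      intro s
      rw [← bowtieMul_mulRight]; simp
    rw [h1, ← bowtie_mul_right, LinearMap.rTensor_tmul, bowtieMul_tmul]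
    simp [LinearMap.lTensor]

theorem bowtieMul_assoc (x y z : OpDual K A ⊗[K] A) :
    bowtieMul K A (bowtieMul K A x y) z = bowtieMul K A x (bowtieMul K A y z) := by
  induction x with
  | zero => simp
  | add x y hx hy => simp only [map_add, LinearMap.add_apply, hx, hy]
  | tmul f a =>
  induction y with
  | zero => simp
  | add x y hx hy => simp only [map_add, LinearMap.add_apply, hx, hy]
  | tmul g b =>
  induction z with
  | zero => simp
  | add x y hx hy => simp only [map_add, hx, hy]
  | tmul h c =>
  have e : ∀ (f : OpDual K A) (c : A) (t : OpDual K A ⊗[K] A),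
      TensorProduct.map (LinearMap.mulLeft K f) (LinearMap.mulRight K c) t =
      LinearMap.rTensor A (LinearMap.mulLeft K f)
        (LinearMap.lTensor (OpDual K A) (LinearMap.mulRight K c) t) := by
    intro f c t
    rw [← LinearMap.comp_apply, LinearMap.rTensor_comp_lTensor]
  have e1 : f ⊗ₜ[K] a = LinearMap.rTensor A (LinearMap.mulLeft K f) (1 ⊗ₜ a) := by simp
  have e2 : h ⊗ₜ[K] c = LinearMap.lTensor (OpDual K A) (LinearMap.mulRight K c) (h ⊗ₜ 1) := by
    simp
  have e3 : g ⊗ₜ[K] b = LinearMap.rTensor A (LinearMap.mulLeft K g) (1 ⊗ₜ b) := by simp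
  rw [bowtieMul_tmul f g, e, bowtieMul_mulLeft, e2, bowtieMul_mulRight, bowtieMul_aux_left,
    e1, bowtieMul_mulLeft, e3, bowtieMul_mulLeft, bowtieMul_aux_right, bowtieMul_mulRight,
    bowtieMul_mulRight, bowtieMul_tmul]
  simp

end OpDual

end Bowtie

section Double

variable (K A : Type*) [Field K] [Ring A] [HopfAlgebra K A]

/-- The double `D(A)`: the vector space `A° ⊗ A`, in which `λ ⊗ a` stands for the product `λ · a`,
with the multiplication determined by `a · λ = ⋈(a ⊗ λ)` and the comultiplication of the tensor
product coalgebra. -/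
def DrinfeldDouble : Type _ := OpDual K A ⊗[K] A

namespace DrinfeldDouble

instance instAddCommGroup : AddCommGroup (DrinfeldDouble K A) :=
  inferInstanceAs (AddCommGroup (OpDual K A ⊗[K] A))

instance : Module K (DrinfeldDouble K A) := inferInstanceAs (Module K (OpDual K A ⊗[K] A))

/-- The isomorphism `A° ⊗ A → D(A)`, `λ ⊗ a ↦ λ · a`. -/
def ofTensor : OpDual K A ⊗[K] A ≃ₗ[K] DrinfeldDouble K A := LinearEquiv.refl K _

variable {K A}

variable [FiniteDimensional K A]

instance : Coalgebra K (DrinfeldDouble K A) := inferInstanceAs (Coalgebra K (OpDual K A ⊗[K] A))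

variable [InvertibleAntipode K A]

instance : Ring (DrinfeldDouble K A) where
  __ := instAddCommGroup K A
  mul x y := ofTensor K A (bowtieMul K A ((ofTensor K A).symm x) ((ofTensor K A).symm y))
  one := ofTensor K A (1 ⊗ₜ 1)
  left_distrib x y z := map_add (bowtieMul K A x) y z
  right_distrib x y z := LinearMap.map_add₂ (bowtieMul K A) x y z
  zero_mul x := LinearMap.map_zero₂ (bowtieMul K A) x
  mul_zero x := map_zero (bowtieMul K A x)
  mul_assoc x y z := OpDual.bowtieMul_assoc x y z
  one_mul x := OpDual.bowtieMul_one_left x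
  mul_one x := OpDual.bowtieMul_one_right x

instance : Algebra K (DrinfeldDouble K A) :=
  Algebra.ofModule (fun c x y => LinearMap.map_smul₂ (bowtieMul K A) c x y)
    (fun c x y => map_smul (bowtieMul K A x) c y)

theorem ofTensor_mul (x y : OpDual K A ⊗[K] A) :
    ofTensor K A x * ofTensor K A y = ofTensor K A (bowtieMul K A x y) := rfl

variable (K A)

/-- The inclusion of `A` into `D(A)`. -/
def inclA : A →ₐ[K] DrinfeldDouble K A :=
  AlgHom.ofLinearMap ((ofTensor K A).toLinearMap ∘ₗ TensorProduct.mk K (OpDual K A) A 1) rfl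
    (by
      intro a b
      change ofTensor K A (1 ⊗ₜ (a * b)) = ofTensor K A (bowtieMul K A (1 ⊗ₜ a) (1 ⊗ₜ b))
      rw [OpDual.bowtieMul_tmul, OpDual.bowtie_one_right]
      simp)

/-- The inclusion of `A°` into `D(A)`. -/
def inclDual : OpDual K A →ₐ[K] DrinfeldDouble K A :=
  AlgHom.ofLinearMap ((ofTensor K A).toLinearMap ∘ₗ (TensorProduct.mk K (OpDual K A) A).flip 1) rfl
    (by
      intro f g
      change ofTensor K A ((f * g) ⊗ₜ 1) = ofTensor K A (bowtieMul K A (f ⊗ₜ 1) (g ⊗ₜ 1))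
      rw [OpDual.bowtieMul_tmul, OpDual.bowtie_one_left]
      simp)

variable {K A}

theorem ofTensor_tmul (f : OpDual K A) (a : A) :
    ofTensor K A (f ⊗ₜ a) = inclDual K A f * inclA K A a := by
  change _ = ofTensor K A (bowtieMul K A (f ⊗ₜ 1) (1 ⊗ₜ a))
  rw [OpDual.bowtieMul_tmul, OpDual.bowtie_one_left]
  simp

theorem inclA_mul_inclDual (a : A) (f : OpDual K A) :
    inclA K A a * inclDual K A f = ofTensor K A (bowtie K A (a ⊗ₜ f)) := by
  change ofTensor K A (bowtieMul K A (1 ⊗ₜ a) (f ⊗ₜ 1)) = _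
  rw [OpDual.bowtieMul_tmul]
  congr 1
  generalize bowtie K A (a ⊗ₜ f) = t
  induction t with
  | zero => simp
  | add x y hx hy => simp only [map_add, hx, hy]
  | tmul g m => simp

@[elab_as_elim]
theorem induction {P : DrinfeldDouble K A → Prop} (h0 : P 0) (hadd : ∀ x y, P x → P y → P (x + y))
    (hmul : ∀ f a, P (inclDual K A f * inclA K A a)) (x : DrinfeldDouble K A) : P x := by
  induction x using TensorProduct.induction_on with
  | zero => exact h0
  | add x y hx hy => exact hadd x y hx hy
  | tmul f a =>
    have h := hmul f a
    rw [← ofTensor_tmul] at h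
    exact h

/-- The inclusion `A ⊗ A → D(A) ⊗ D(A)`. -/
abbrev inclA₂ : A ⊗[K] A →ₐ[K] DrinfeldDouble K A ⊗[K] DrinfeldDouble K A :=
  Algebra.TensorProduct.map (inclA K A) (inclA K A)

/-- The inclusion `A° ⊗ A° → D(A) ⊗ D(A)`. -/
abbrev inclDual₂ :
    OpDual K A ⊗[K] OpDual K A →ₐ[K] DrinfeldDouble K A ⊗[K] DrinfeldDouble K A :=
  Algebra.TensorProduct.map (inclDual K A) (inclDual K A)

theorem comul_mk (f : OpDual K A) (a : A) :
    comul (R := K) (inclDual K A f * inclA K A a) =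
      inclDual₂ (comul f) * inclA₂ (comul a) := by
  rw [← ofTensor_tmul]
  have hid : ∀ w : (OpDual K A ⊗[K] A) ⊗[K] (OpDual K A ⊗[K] A),
      TensorProduct.map (ofTensor K A).toLinearMap (ofTensor K A).toLinearMap w = w :=
    fun w => congr($(TensorProduct.map_id (R := K) (M := OpDual K A ⊗[K] A)
      (N := OpDual K A ⊗[K] A)) w)
  refine (hid (TensorProduct.tensorTensorTensorComm K _ _ _ _
    (comul (R := K) f ⊗ₜ comul (R := K) a))).symm.trans ?_
  generalize comul (R := K) f = s
  generalize comul (R := K) a = t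
  induction s with
  | zero => simp
  | add x y hx hy => simp only [TensorProduct.add_tmul, map_add, add_mul, hx, hy]
  | tmul f g =>
  induction t with
  | zero => simp
  | add x y hx hy => simp only [TensorProduct.tmul_add, map_add, mul_add, hx, hy]
  | tmul a b => simp [ofTensor_tmul]

theorem counit_mk (f : OpDual K A) (a : A) :
    counit (R := K) (inclDual K A f * inclA K A a) = counit (R := K) f * counit (R := K) a := by
  rw [← ofTensor_tmul]
  change counit (R := K) a • counit (R := K) f = _
  rw [smul_eq_mul, mul_comm]

theorem ext_evL₂ {t s : DrinfeldDouble K A ⊗[K] DrinfeldDouble K A}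
    (h : ∀ x y, TensorProduct.map (OpDual.evL A x ∘ₗ (ofTensor K A).symm.toLinearMap)
        (OpDual.evL A y ∘ₗ (ofTensor K A).symm.toLinearMap) t =
      TensorProduct.map (OpDual.evL A x ∘ₗ (ofTensor K A).symm.toLinearMap)
        (OpDual.evL A y ∘ₗ (ofTensor K A).symm.toLinearMap) s) : t = s := by
  let e : DrinfeldDouble K A ≃ₗ[K] (A →ₗ[K] A) := (ofTensor K A).symm ≪≫ₗ
    (OpDual.toDual K A).rTensor A ≪≫ₗ dualTensorHomEquiv K A A
  apply (TensorProduct.congr e e ≪≫ₗ homTensorHomEquiv K A A A A).injective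
  apply TensorProduct.ext'
  intro x y
  have h1 : ∀ t : DrinfeldDouble K A ⊗[K] DrinfeldDouble K A,
      (TensorProduct.congr e e ≪≫ₗ homTensorHomEquiv K A A A A) t (x ⊗ₜ y) =
      TensorProduct.map (OpDual.evL A x ∘ₗ (ofTensor K A).symm.toLinearMap)
        (OpDual.evL A y ∘ₗ (ofTensor K A).symm.toLinearMap) t := by
    intro t
    induction t with
    | zero => simp
    | add x y hx hy => simp only [map_add, LinearMap.add_apply, hx, hy]
    | tmul u v =>
      simp [homTensorHomEquiv_apply]
      rfl
  rw [h1, h1, h]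

theorem coassoc_aux₂ :
    TensorProduct.map (comul₂ K A) (comul₂ K A) ∘ₗ comul =
      (TensorProduct.assoc K A (A ⊗[K] A) (A ⊗[K] (A ⊗[K] A))).symm.toLinearMap ∘ₗ
      LinearMap.lTensor A (TensorProduct.assoc K A A (A ⊗[K] (A ⊗[K] A))).symm.toLinearMap ∘ₗ
      LinearMap.lTensor A (LinearMap.lTensor A (TensorProduct.assoc K A A (A ⊗[K] A)).toLinearMap) ∘ₗ
      LinearMap.lTensor A (LinearMap.lTensor A
        (TensorProduct.assoc K (A ⊗[K] A) A A).toLinearMap) ∘ₗ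
      LinearMap.lTensor A (TensorProduct.assoc K A ((A ⊗[K] A) ⊗[K] A) A).toLinearMap ∘ₗ
      LinearMap.lTensor A (LinearMap.rTensor A (LinearMap.lTensor A (LinearMap.rTensor A comul))) ∘ₗ
      LinearMap.lTensor A (LinearMap.rTensor A (comul₂ K A)) ∘ₗ comul₂ K A := by
  simp only [comul₂, coassoc_simps]

theorem comul_inclA_mul_inclDual (a : A) (f : OpDual K A) :
    comul (R := K) (inclA K A a * inclDual K A f) =
      inclA₂ (comul a) * inclDual₂ (comul f) := by
  refine ext_evL₂ fun x y => ?_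
  have h1 : ∀ z : DrinfeldDouble K A,
      TensorProduct.map (OpDual.evL A x ∘ₗ (ofTensor K A).symm.toLinearMap)
        (OpDual.evL A y ∘ₗ (ofTensor K A).symm.toLinearMap) (comul (R := K) z) =
      comul (R := K) (OpDual.evL A (y * x) ((ofTensor K A).symm z)) := by
    intro z
    induction z using induction with
    | h0 => simp
    | hadd x y hx hy => simp only [map_add, hx, hy]
    | hmul g b =>
      rw [comul_mk, ← ofTensor_tmul, LinearEquiv.symm_apply_apply, OpDual.evL_tmul, map_smul,
        ← OpDual.pair_comul_tmul]
      generalize comul (R := K) g = s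
      generalize comul (R := K) b = t
      induction s with
      | zero => simp
      | add x y hx hy => simp only [map_add, add_mul, LinearMap.add_apply, add_smul, hx, hy]
      | tmul f g =>
      induction t with
      | zero => simp
      | add x y hx hy => simp only [map_add, mul_add, smul_add, hx, hy]
      | tmul a b =>
        simp [← ofTensor_tmul, ← TensorProduct.smul_tmul', mul_smul, smul_comm (g y)]
  rw [h1, inclA_mul_inclDual, LinearEquiv.symm_apply_apply, OpDual.evL_bowtie_eq, OpDual.map_sandM]
  rw [← (ℛ K f).eq]
  have h2 : ∀ (g h : OpDual K A) (t : A ⊗[K] A),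
      TensorProduct.map (OpDual.evL A x ∘ₗ (ofTensor K A).symm.toLinearMap)
        (OpDual.evL A y ∘ₗ (ofTensor K A).symm.toLinearMap) (inclA₂ t * inclDual₂ (g ⊗ₜ h)) =
      TensorProduct.map (OpDual.sandM A x g) (OpDual.sandM A y h)
        (TensorProduct.map (comul₂ K A) (comul₂ K A) t) := by
    intro g h t
    induction t with
    | zero => simp
    | add x y hx hy => simp only [map_add, add_mul, hx, hy]
    | tmul a b => simp [inclA_mul_inclDual, OpDual.evL_bowtie_eq]
  simp only [map_sum, Finset.mul_sum, h2]
  have h3 := congr($(coassoc_aux₂ (K := K) (A := A)) a)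
  simp only [LinearMap.comp_apply] at h3
  rw [h3]
  generalize comul₂ K A a = u
  induction u with
  | zero => simp
  | add x y hx hy => simp only [map_add, hx, hy, Finset.sum_add_distrib]
  | tmul p u =>
  induction u with
  | zero => simp
  | add x y hx hy => simp only [TensorProduct.tmul_add, map_add, hx, hy, Finset.sum_add_distrib]
  | tmul m r =>
  simp only [LinearMap.lTensor_tmul, LinearMap.rTensor_tmul, OpDual.sandM_tmul]
  have h4 : ∀ q z q' : A, ∑ i ∈ (ℛ K f).index,
      TensorProduct.map (OpDual.sandM A x ((ℛ K f).left i)) (OpDual.sandM A y ((ℛ K f).right i))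
        ((TensorProduct.assoc K A (A ⊗[K] A) (A ⊗[K] (A ⊗[K] A))).symm.toLinearMap
          (p ⊗ₜ (TensorProduct.assoc K A A (A ⊗[K] (A ⊗[K] A))).symm.toLinearMap
            (LinearMap.lTensor A (TensorProduct.assoc K A A (A ⊗[K] A)).toLinearMap
              (LinearMap.lTensor A (TensorProduct.assoc K (A ⊗[K] A) A A).toLinearMap
                ((TensorProduct.assoc K A ((A ⊗[K] A) ⊗[K] A) A).toLinearMap
                  ((q ⊗ₜ (comul (R := K) z ⊗ₜ q')) ⊗ₜ r)))))) =
      (counit (R := K) z * f (antipodeInv K A r * (y * x * p))) • (q ⊗ₜ q') := by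
    intro q z q'
    have h5 : ∀ s : A ⊗[K] A, ∑ i ∈ (ℛ K f).index,
        TensorProduct.map (OpDual.sandM A x ((ℛ K f).left i)) (OpDual.sandM A y ((ℛ K f).right i))
          ((TensorProduct.assoc K A (A ⊗[K] A) (A ⊗[K] (A ⊗[K] A))).symm.toLinearMap
            (p ⊗ₜ (TensorProduct.assoc K A A (A ⊗[K] (A ⊗[K] A))).symm.toLinearMap
              (LinearMap.lTensor A (TensorProduct.assoc K A A (A ⊗[K] A)).toLinearMap
                (LinearMap.lTensor A (TensorProduct.assoc K (A ⊗[K] A) A A).toLinearMap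
                  ((TensorProduct.assoc K A ((A ⊗[K] A) ⊗[K] A) A).toLinearMap
                    ((q ⊗ₜ (s ⊗ₜ q')) ⊗ₜ r)))))) =
        f (antipodeInv K A r * y * LinearMap.mul' K A (TensorProduct.comm K A A
          (LinearMap.rTensor A (antipodeInv K A) s)) * (x * p)) • (q ⊗ₜ q') := by
      intro s
      induction s with
      | zero => simp
      | add x y hx hy =>
        simp only [TensorProduct.tmul_add, TensorProduct.add_tmul, map_add, hx, hy,
          Finset.sum_add_distrib, mul_add, add_mul, add_smul]
      | tmul z z' =>
        have h6 := OpDual.pair_comul_tmul f (antipodeInv K A z * (x * p))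
          (antipodeInv K A r * (y * z'))
        rw [← (ℛ K f).eq] at h6
        simp only [map_sum, LinearMap.sum_apply, OpDual.pair_tmul] at h6
        simp only [LinearMap.rTensor_tmul, TensorProduct.comm_tmul, LinearMap.mul'_apply]
        have h7 : antipodeInv K A r * y * (z' * antipodeInv K A z) * (x * p) =
          antipodeInv K A r * (y * z') * (antipodeInv K A z * (x * p)) := by
          simp only [mul_assoc]
        rw [h7, ← h6, Finset.sum_smul]
        refine Finset.sum_congr rfl fun i _ => ?_
        simp [← TensorProduct.smul_tmul', smul_smul, mul_comm]
    rw [h5, mul_antipodeInv_left]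
    simp [mul_assoc]
  have h8 : ∀ w : A ⊗[K] (A ⊗[K] A), ∑ i ∈ (ℛ K f).index,
      TensorProduct.map (OpDual.sandM A x ((ℛ K f).left i)) (OpDual.sandM A y ((ℛ K f).right i))
        ((TensorProduct.assoc K A (A ⊗[K] A) (A ⊗[K] (A ⊗[K] A))).symm.toLinearMap
          (p ⊗ₜ (TensorProduct.assoc K A A (A ⊗[K] (A ⊗[K] A))).symm.toLinearMap
            (LinearMap.lTensor A (TensorProduct.assoc K A A (A ⊗[K] A)).toLinearMap
              (LinearMap.lTensor A (TensorProduct.assoc K (A ⊗[K] A) A A).toLinearMap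
                ((TensorProduct.assoc K A ((A ⊗[K] A) ⊗[K] A) A).toLinearMap
                  ((LinearMap.lTensor A (LinearMap.rTensor A comul) w) ⊗ₜ r)))))) =
      f (antipodeInv K A r * (y * x * p)) • LinearMap.lTensor A
        ((TensorProduct.lid K A).toLinearMap ∘ₗ LinearMap.rTensor A counit) w := by
    intro w
    induction w with
    | zero => simp
    | add x y hx hy =>
      simp only [TensorProduct.tmul_add, TensorProduct.add_tmul, map_add, hx, hy,
        Finset.sum_add_distrib, smul_add]
    | tmul q w =>
    induction w with
    | zero => simp
    | add x y hx hy =>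
      simp only [TensorProduct.tmul_add, TensorProduct.add_tmul, map_add, hx, hy,
        Finset.sum_add_distrib, smul_add]
    | tmul z q' =>
      rw [LinearMap.lTensor_tmul, LinearMap.rTensor_tmul, h4]
      simp [smul_smul, mul_comm]
  rw [h8]
  congr 1
  rw [comul₂, LinearMap.comp_apply, ← LinearMap.comp_apply, ← LinearMap.lTensor_comp,
    LinearMap.comp_assoc, rTensor_counit_comp_comul]
  have h9 : (TensorProduct.lid K A).toLinearMap ∘ₗ TensorProduct.mk K K A 1 = LinearMap.id := by
    ext; simp
  rw [h9, LinearMap.lTensor_id, LinearMap.id_apply]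

theorem comul_mul_eq (x y : DrinfeldDouble K A) :
    comul (R := K) (x * y) = comul x * comul y := by
  -- left multiplication by `A°`, right multiplication by `A`
  have hl : ∀ (f : OpDual K A) (z : DrinfeldDouble K A),
      comul (R := K) (inclDual K A f * z) = inclDual₂ (comul f) * comul z := by
    intro f z
    induction z using induction with
    | h0 => simp
    | hadd x y hx hy => simp only [mul_add, map_add, hx, hy]
    | hmul g b => rw [← mul_assoc, ← map_mul, comul_mk, comul_mk, Bialgebra.comul_mul, map_mul, mul_assoc]
  have hr : ∀ (a : A) (z : DrinfeldDouble K A),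
      comul (R := K) (z * inclA K A a) = comul z * inclA₂ (comul a) := by
    intro a z
    induction z using induction with
    | h0 => simp
    | hadd x y hx hy => simp only [add_mul, map_add, hx, hy]
    | hmul g b => rw [mul_assoc, ← map_mul, comul_mk, comul_mk, Bialgebra.comul_mul, map_mul, mul_assoc]
  induction x using induction with
  | h0 => simp
  | hadd x y hx hy => simp only [add_mul, map_add, hx, hy]
  | hmul f a =>
  induction y using induction with
  | h0 => simp
  | hadd x y hx hy => simp only [mul_add, map_add, hx, hy]
  | hmul g b =>
  rw [mul_assoc, hl, ← mul_assoc, hr, comul_inclA_mul_inclDual, comul_mk, comul_mk]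
  simp only [mul_assoc]

theorem counit_mul_eq (x y : DrinfeldDouble K A) :
    counit (R := K) (x * y) = counit (R := K) x * counit (R := K) y := by
  have hl : ∀ (f : OpDual K A) (z : DrinfeldDouble K A),
      counit (R := K) (inclDual K A f * z) = counit (R := K) f * counit (R := K) z := by
    intro f z
    induction z using induction with
    | h0 => simp
    | hadd x y hx hy => simp only [mul_add, map_add, hx, hy]
    | hmul g b => rw [← mul_assoc, ← map_mul, counit_mk, counit_mk, Bialgebra.counit_mul, mul_assoc]
  have hr : ∀ (a : A) (z : DrinfeldDouble K A),
      counit (R := K) (z * inclA K A a) = counit (R := K) z * counit (R := K) a := by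
    intro a z
    induction z using induction with
    | h0 => simp
    | hadd x y hx hy => simp only [add_mul, map_add, hx, hy]
    | hmul g b => rw [mul_assoc, ← map_mul, counit_mk, counit_mk, Bialgebra.counit_mul, mul_assoc]
  have hm : ∀ (a : A) (f : OpDual K A), counit (R := K) (inclA K A a * inclDual K A f) =
      counit (R := K) a * counit (R := K) f := by
    intro a f
    have h0 : ∀ t : OpDual K A ⊗[K] A, counit (R := K) (ofTensor K A t) =
        counit (R := K) (OpDual.evL A 1 t) := by
      intro t
      induction t with
      | zero => simp
      | add x y hx hy => simp only [map_add, hx, hy]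
      | tmul f a => rw [ofTensor_tmul, counit_mk]; simp
    have h1 : ∀ t : A ⊗[K] A, counit (R := K) (OpDual.sandM A 1 f (LinearMap.lTensor A comul t)) =
        f (LinearMap.mul' K A (TensorProduct.comm K A A
          (LinearMap.lTensor A (antipodeInv K A) t))) := by
      intro t
      induction t with
      | zero => simp
      | add x y hx hy => simp only [map_add, hx, hy]
      | tmul p z =>
        have h2 : ∀ s : A ⊗[K] A, counit (R := K) (OpDual.sandM A 1 f (p ⊗ₜ s)) =
            f (antipodeInv K A (TensorProduct.lid K A (LinearMap.rTensor A counit s)) * p) := by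
          intro s
          induction s with
          | zero => simp
          | add x y hx hy => simp only [TensorProduct.tmul_add, map_add, add_mul, hx, hy]
          | tmul q r => simp [mul_comm]
        simp [h2]
    rw [inclA_mul_inclDual, h0, OpDual.evL_bowtie_eq, comul₂, LinearMap.comp_apply, h1,
      mul_antipodeInv_right]
    simp
  induction x using induction with
  | h0 => simp
  | hadd x y hx hy => simp only [add_mul, map_add, hx, hy]
  | hmul f a =>
  induction y using induction with
  | h0 => simp
  | hadd x y hx hy => simp only [mul_add, map_add, hx, hy]
  | hmul g b =>
  rw [mul_assoc, hl, ← mul_assoc, hr, hm, counit_mk, counit_mk]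
  simp only [mul_assoc]

instance : Bialgebra K (DrinfeldDouble K A) :=
  Bialgebra.mk' K (DrinfeldDouble K A)
    (by simpa using counit_mk (K := K) (A := A) 1 1)
    (fun {x y} => counit_mul_eq x y)
    (by simpa using comul_mk (K := K) (A := A) 1 1)
    (fun {x y} => comul_mul_eq x y)

variable (K A) in
/-- The antipode of the double, `S(λ · a) = S(a) · S(λ)`. -/
def doubleAntipode : DrinfeldDouble K A →ₗ[K] DrinfeldDouble K A :=
  TensorProduct.lift ((LinearMap.mul K (DrinfeldDouble K A)).flip.compl₁₂
    ((inclDual K A).toLinearMap ∘ₗ antipode K) ((inclA K A).toLinearMap ∘ₗ antipode K)) ∘ₗ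
    (ofTensor K A).symm.toLinearMap

theorem doubleAntipode_mk (f : OpDual K A) (a : A) :
    doubleAntipode K A (inclDual K A f * inclA K A a) =
      inclA K A (antipode K a) * inclDual K A (antipode K f) := by
  rw [← ofTensor_tmul]
  simp [doubleAntipode]

instance : HopfAlgebra K (DrinfeldDouble K A) where
  antipode := doubleAntipode K A
  mul_antipode_rTensor_comul := by
    ext x
    simp only [LinearMap.comp_apply]
    induction x using induction with
    | h0 => simp
    | hadd x y hx hy => simp only [map_add, hx, hy]
    | hmul f a =>
      rw [comul_mk, counit_mk]
      have h1 : ∀ (a b : A) (s : OpDual K A ⊗[K] OpDual K A),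
          LinearMap.mul' K _ (LinearMap.rTensor _ (doubleAntipode K A)
            (inclDual₂ s * inclA₂ (a ⊗ₜ b))) =
          inclA K A (antipode K a) * inclDual K A
            (LinearMap.mul' K _ (LinearMap.rTensor _ (antipode K) s)) * inclA K A b := by
        intro a b s
        induction s with
        | zero => simp
        | add x y hx hy => simp only [map_add, add_mul, mul_add, hx, hy]
        | tmul f g => simp [doubleAntipode_mk, mul_assoc]
      have h2 : ∀ t : A ⊗[K] A,
          LinearMap.mul' K _ (LinearMap.rTensor _ (doubleAntipode K A)
            (inclDual₂ (comul f) * inclA₂ t)) =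
          counit (R := K) f • inclA K A (LinearMap.mul' K _ (LinearMap.rTensor _ (antipode K) t)) := by
        intro t
        induction t with
        | zero => simp
        | add x y hx hy => simp only [map_add, mul_add, smul_add, hx, hy]
        | tmul a b =>
          rw [h1, mul_antipode_rTensor_comul_apply]
          simp [Algebra.algebraMap_eq_smul_one]
      rw [h2, mul_antipode_rTensor_comul_apply]
      simp [Algebra.algebraMap_eq_smul_one, smul_smul]
  mul_antipode_lTensor_comul := by
    ext x
    simp only [LinearMap.comp_apply]
    induction x using induction with
    | h0 => simp
    | hadd x y hx hy => simp only [map_add, hx, hy]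
    | hmul f a =>
      rw [comul_mk, counit_mk]
      have h1 : ∀ (f g : OpDual K A) (t : A ⊗[K] A),
          LinearMap.mul' K _ (LinearMap.lTensor _ (doubleAntipode K A)
            (inclDual₂ (f ⊗ₜ g) * inclA₂ t)) =
          inclDual K A f * inclA K A
            (LinearMap.mul' K _ (LinearMap.lTensor _ (antipode K) t)) *
            inclDual K A (antipode K g) := by
        intro f g t
        induction t with
        | zero => simp
        | add x y hx hy => simp only [map_add, add_mul, mul_add, hx, hy]
        | tmul a b => simp [doubleAntipode_mk, mul_assoc]
      have h2 : ∀ s : OpDual K A ⊗[K] OpDual K A,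
          LinearMap.mul' K _ (LinearMap.lTensor _ (doubleAntipode K A)
            (inclDual₂ s * inclA₂ (comul a))) =
          counit (R := K) a •
            inclDual K A (LinearMap.mul' K _ (LinearMap.lTensor _ (antipode K) s)) := by
        intro s
        induction s with
        | zero => simp
        | add x y hx hy => simp only [map_add, add_mul, smul_add, hx, hy]
        | tmul f g =>
          rw [h1, mul_antipode_lTensor_comul_apply]
          simp [Algebra.algebraMap_eq_smul_one]
      rw [h2, mul_antipode_lTensor_comul_apply]
      simp [Algebra.algebraMap_eq_smul_one, smul_smul, mul_comm]

end DrinfeldDouble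

end Double

section Balancing

variable {K D : Type*} [Field K] [Ring D] [HopfAlgebra K D]

/-- `u = ∑ S(R₂) R₁` for `R = ∑ R₁ ⊗ R₂`. -/
def drinfeldElement (R : D ⊗[K] D) : D :=
  LinearMap.mul' K D (LinearMap.rTensor D (antipode K) (TensorProduct.comm K D D R))

/-- `û = ∑ S²(R₁) R₂` for `R = ∑ R₁ ⊗ R₂`. -/
def drinfeldElementHat (R : D ⊗[K] D) : D :=
  LinearMap.mul' K D (LinearMap.rTensor D (antipode K ∘ₗ antipode K) R)

/-- The canonical element `g = u û`, which implements `S⁴` when `R` is a universal `R`-matrix. -/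
def canonicalElement (R : D ⊗[K] D) : D :=
  drinfeldElement R * drinfeldElementHat R

/-- A balancing of a Hopf algebra `D` with universal `R`-matrix `R` : a group-like `k` with
`k² = g` and `S²(y) = k y k⁻¹`. (Group-likes are units, so `Ring.inverse k` is `k⁻¹`.) -/
structure IsBalancing (R : D ⊗[K] D) (k : D) : Prop where
  isGroupLikeElem : IsGroupLikeElem K k
  canonicalElement_eq : canonicalElement R = k ^ 2
  antipode_antipode_eq : ∀ y : D, antipode K (antipode K y) = k * y * Ring.inverse k

end Balancing

section Moduli

variable (K : Type*) {A : Type*} [Field K] [Ring A] [HopfAlgebra K A]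

/-- Left integrals: `(1 ⊗ μ) Δ(h) = μ(h) 1`. -/
def IsLeftIntegral (μ : Module.Dual K A) : Prop :=
  ∀ h : A, TensorProduct.rid K A (LinearMap.lTensor A μ (comul h)) = μ h • (1 : A)

/-- Left cointegrals: `h x = ε(h) x`. -/
def IsLeftCointegral (x : A) : Prop :=
  ∀ h : A, h * x = counit (R := K) h • x

/-- `α` is the modulus of `A` : `x h = α(h) x` for a nonzero left cointegral `x`. -/
def IsModulus (α : OpDual K A) : Prop :=
  ∃ x : A, x ≠ 0 ∧ IsLeftCointegral K x ∧ ∀ h : A, x * h = α h • x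

/-- `a` is the comodulus of `A` : `(μ ⊗ 1) Δ(h) = μ(h) a` for a nonzero left integral `μ`. -/
def IsComodulus (a : A) : Prop :=
  ∃ μ : Module.Dual K A, μ ≠ 0 ∧ IsLeftIntegral K μ ∧
    ∀ h : A, TensorProduct.lid K A (LinearMap.rTensor A μ (comul h)) = μ h • a

/-- The adjoint action `ad(a)(y) = ∑ a₁ y S(a₂)` of `A` on itself. -/
def adjointAction (a y : A) : A :=
  LinearMap.mul' K A (TensorProduct.map (LinearMap.mulRight K y) (antipode K) (comul a))

variable {K}

/-- `λ ⇀ y = ∑ ⟨λ, y₂⟩ y₁`. -/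
def leftHit (f : OpDual K A) : A →ₗ[K] A :=
  (TensorProduct.rid K A).toLinearMap ∘ₗ
    LinearMap.lTensor A (OpDual.toDual K A f) ∘ₗ comul

/-- `y ↼ λ = ∑ ⟨λ, y₁⟩ y₂`. -/
def rightHit (f : OpDual K A) : A →ₗ[K] A :=
  (TensorProduct.lid K A).toLinearMap ∘ₗ
    LinearMap.rTensor A (OpDual.toDual K A f) ∘ₗ comul

/-- The coadjoint action of a group-like `γ` of `A°` on `A` : `ad*(γ)(y) = γ ⇀ y ↼ γ⁻¹`. -/
def coadjointAction [FiniteDimensional K A] [InvertibleAntipode K A]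
    (γ : GroupLike K (OpDual K A)) (y : A) : A :=
  leftHit (γ : OpDual K A) (rightHit ((γ⁻¹ : GroupLike K (OpDual K A)) : OpDual K A) y)

end Moduli

namespace DrinfeldDouble

variable (K A : Type*) [Field K] [Ring A] [HopfAlgebra K A] [FiniteDimensional K A]
  [InvertibleAntipode K A]

/-- The universal `R`-matrix `∑ eᵢ ⊗ fᵢ` of `D(A)`, for dual bases `eᵢ` of `A` and `fᵢ` of `A°`. -/
def universalR : DrinfeldDouble K A ⊗[K] DrinfeldDouble K A :=
  TensorProduct.map (inclA K A).toLinearMap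
    ((inclDual K A).toLinearMap ∘ₗ (OpDual.toDual K A).symm.toLinearMap) (coevaluation K A 1)

variable {K A}

/-- The canonical trace `χ(λ · y) = λ(y)` on `D(A)`. -/
def chi : DrinfeldDouble K A →ₗ[K] K :=
  contractLeft K A ∘ₗ LinearMap.rTensor A (OpDual.toDual K A).toLinearMap ∘ₗ
    (ofTensor K A).symm.toLinearMap

/-- The number `ν` of a balancing `k`, given by `ν⁻¹ = χ(k)`. -/
def nu (k : DrinfeldDouble K A) : K := (chi k)⁻¹

end DrinfeldDouble

end

open scoped TensorProduct
open Coalgebra HopfAlgebra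

/-! Everything rests on one formula, `canonicalElement_eq`: g = α · S(a) in D(A), where S(a) = a⁻¹.
To prove it, elements of D(A) = A° ⊗ A are read as endomorphisms of A. Under this reading u becomes
S⁻¹. For û, choose a left integral μ and a left cointegral Λ with μ(Λ) = 1. Then ∑ S⁻¹(Λ₁) ⊗ μ(· Λ₂)
is the canonical element of A ⊗ A*, so û = ∑ S(Λ₁) · μ(· Λ₂). Reordering this product and cancelling
one antipode pair gives x ↦ ∑ μ(Λ₁ x) S(Λ₂). The modulus moves x to the other leg and the comodulus
evaluates what is left, giving x ↦ S²(x ↼ α) S(a). Multiplying by u removes S² and leaves x ↦ α(x)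
S(a), which is the element α · S(a). The normalisation μ(Λ) = 1 is possible because a nonzero left
integral is nondegenerate and so cannot vanish on Λ.

As a coalgebra D(A) is a tensor product, so its group-likes are exactly the products γ b of
group-likes, with unique factors. Such γ and b commute in D(A). Hence k² = g says γ² = α and b² =
a⁻¹, that is, √a = b⁻¹. Conjugation by γ b acts on A as ad*(γ) ∘ ad(b), and if it equals S² on A
then, by duality, it equals S² on A° and so on D(A).

For the second part, γ is a character of A and evaluation at a group-like c is a character of A°. So
χ(γ c⁻¹) = γ(c)⁻¹ and ν = γ(c). Moving squares between the two arguments gives ν⁴ = γ²(c²) = α(a).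
For two balancings, γ'(c')² = γ'(a) = γ'(c)² = α(c) = γ(c)². Finally ν is a root of unity because γ
has finite order. -/

noncomputable section

/-! ### Integrals and cointegrals: moving an element from one tensor leg to the other. -/

section Convolution

variable {K A : Type*} [Field K] [Ring A] [HopfAlgebra K A]

open WithConv Algebra.TensorProduct in
/-- `∑ (S(h₁) ⊗ 1) Δ(h₂) = 1 ⊗ h`. -/
theorem antipode_tmul_one_mul_comul (h : A) :
    LinearMap.mul' K (A ⊗[K] A) (TensorProduct.map
      (includeLeft.toLinearMap ∘ₗ antipode K : A →ₗ[K] A ⊗[K] A) comul (comul h)) = 1 ⊗ₜ h := by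
  -- In the convolution algebra Hom(A, A ⊗ A), Δ is the product ι₁ * ι₂ of the two inclusions, and
  -- ι₁ ∘ S is a left inverse of ι₁. Hence (ι₁ ∘ S) * Δ = ι₂, which is the claim.
  have h1 : toConv (includeLeft.toLinearMap : A →ₗ[K] A ⊗[K] A) *
      toConv (includeRight.toLinearMap : A →ₗ[K] A ⊗[K] A) = toConv comul := by
    ext a
    simp only [LinearMap.convMul_apply]
    change _ = comul a
    generalize comul (R := K) a = t
    induction t with
    | zero => simp
    | add x y hx hy => simp only [map_add, hx, hy]
    | tmul x y => simp
  have h2 : toConv (includeLeft.toLinearMap ∘ₗ antipode K : A →ₗ[K] A ⊗[K] A) *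
      toConv (includeLeft.toLinearMap : A →ₗ[K] A ⊗[K] A) = 1 := by
    ext a
    have h3 : ∀ t : A ⊗[K] A, LinearMap.mul' K (A ⊗[K] A) (TensorProduct.map
        (includeLeft.toLinearMap ∘ₗ antipode K : A →ₗ[K] A ⊗[K] A) includeLeft.toLinearMap t) =
        LinearMap.mul' K A (LinearMap.rTensor A (antipode K) t) ⊗ₜ 1 := by
      intro t
      induction t with
      | zero => simp
      | add x y hx hy => simp only [map_add, hx, hy, TensorProduct.add_tmul]
      | tmul x y => simp
    refine (h3 _).trans ?_
    rw [mul_antipode_rTensor_comul_apply]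
    rfl
  have h4 := congr($h2 * toConv (includeRight.toLinearMap : A →ₗ[K] A ⊗[K] A))
  rw [mul_assoc, h1, one_mul] at h4
  exact congr($h4 h)

open WithConv Algebra.TensorProduct in
/-- `∑ Δ(h₁) (1 ⊗ S(h₂)) = h ⊗ 1`. -/
theorem comul_mul_one_tmul_antipode (h : A) :
    LinearMap.mul' K (A ⊗[K] A) (TensorProduct.map comul
      (includeRight.toLinearMap ∘ₗ antipode K : A →ₗ[K] A ⊗[K] A) (comul h)) = h ⊗ₜ 1 := by
  -- The mirror argument: ι₂ ∘ S is a right inverse of ι₂, so Δ * (ι₂ ∘ S) = ι₁.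
  have h1 : toConv (includeLeft.toLinearMap : A →ₗ[K] A ⊗[K] A) *
      toConv (includeRight.toLinearMap : A →ₗ[K] A ⊗[K] A) = toConv comul := by
    ext a
    simp only [LinearMap.convMul_apply]
    change _ = comul a
    generalize comul (R := K) a = t
    induction t with
    | zero => simp
    | add x y hx hy => simp only [map_add, hx, hy]
    | tmul x y => simp
  have h2 : toConv (includeRight.toLinearMap : A →ₗ[K] A ⊗[K] A) *
      toConv (includeRight.toLinearMap ∘ₗ antipode K : A →ₗ[K] A ⊗[K] A) = 1 := by
    ext a
    have h3 : ∀ t : A ⊗[K] A, LinearMap.mul' K (A ⊗[K] A) (TensorProduct.map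
        includeRight.toLinearMap (includeRight.toLinearMap ∘ₗ antipode K : A →ₗ[K] A ⊗[K] A) t) =
        1 ⊗ₜ LinearMap.mul' K A (LinearMap.lTensor A (antipode K) t) := by
      intro t
      induction t with
      | zero => simp
      | add x y hx hy => simp only [map_add, hx, hy, TensorProduct.tmul_add]
      | tmul x y => simp
    refine (h3 _).trans ?_
    rw [mul_antipode_lTensor_comul_apply]
    simp [Algebra.algebraMap_eq_smul_one, one_def]
  have h4 := congr(toConv (includeLeft.toLinearMap : A →ₗ[K] A ⊗[K] A) * $h2)
  rw [← mul_assoc, h1, mul_one] at h4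
  exact congr($h4 h)

/-- `∑ S(h) Λ₁ ⊗ Λ₂ = ∑ Λ₁ ⊗ h Λ₂` for a left cointegral `Λ`. -/
theorem IsLeftCointegral.antipode_tmul_one_mul_comul {Λ : A} (hΛ : IsLeftCointegral K Λ) (h : A) :
    (antipode K h ⊗ₜ[K] (1 : A)) * comul Λ = ((1 : A) ⊗ₜ[K] h) * comul Λ := by
  -- With 1 ⊗ h written as ∑ (S(h₁) ⊗ 1) Δ(h₂), the factor Δ(h₂) meets Δ(Λ) and Δ(h₂ Λ) = ε(h₂)
  -- Δ(Λ).
  rw [← _root_.antipode_tmul_one_mul_comul h]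
  have h1 : ∀ t : A ⊗[K] A, LinearMap.mul' K (A ⊗[K] A) (TensorProduct.map
      (Algebra.TensorProduct.includeLeft.toLinearMap ∘ₗ antipode K : A →ₗ[K] A ⊗[K] A) comul t) *
        comul Λ =
      (antipode K (TensorProduct.rid K A (LinearMap.lTensor A counit t)) ⊗ₜ[K] (1 : A)) *
        comul Λ := by
    intro t
    induction t with
    | zero => simp
    | add x y hx hy => simp only [map_add, add_mul, TensorProduct.add_tmul, hx, hy]
    | tmul x y =>
      simp only [TensorProduct.map_tmul, LinearMap.mul'_apply, mul_assoc, ← Bialgebra.comul_mul,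
        hΛ y, map_smul]
      simp [← TensorProduct.smul_tmul']
  rw [h1]
  simp

/-- `∑ Λ₁ x ⊗ Λ₂ = ∑ α(x₁) Λ₁ ⊗ Λ₂ S(x₂)` if `Λ x = α(x) Λ`. -/
theorem comul_mul_tmul_one {Λ : A} {α : A →ₗ[K] K} (hΛ : ∀ h, Λ * h = α h • Λ) (x : A) :
    comul Λ * (x ⊗ₜ[K] (1 : A)) = comul Λ * ((1 : A) ⊗ₜ[K] antipode K
      (TensorProduct.lid K A (LinearMap.rTensor A α (comul x)))) := by
  -- Here x ⊗ 1 = ∑ Δ(x₁) (1 ⊗ S(x₂)), and Δ(Λ) absorbs Δ(x₁) at the cost of the scalar α(x₁).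
  rw [← comul_mul_one_tmul_antipode x]
  have h1 : ∀ t : A ⊗[K] A, comul Λ * LinearMap.mul' K (A ⊗[K] A) (TensorProduct.map comul
      (Algebra.TensorProduct.includeRight.toLinearMap ∘ₗ antipode K : A →ₗ[K] A ⊗[K] A) t) =
      comul Λ * ((1 : A) ⊗ₜ[K] antipode K
        (TensorProduct.lid K A (LinearMap.rTensor A α t))) := by
    intro t
    induction t with
    | zero => simp
    | add x y hx hy => simp only [map_add, mul_add, TensorProduct.tmul_add, hx, hy]
    | tmul x y =>
      simp only [TensorProduct.map_tmul, LinearMap.mul'_apply, ← mul_assoc, ← Bialgebra.comul_mul,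
        hΛ x, map_smul]
      simp
  rw [h1]

/-- `∑ y₁ μ(h y₂) = ∑ S(h₁) μ(h₂ y)` for a left integral `μ`. -/
theorem IsLeftIntegral.lTensor_mul_comul {μ : Module.Dual K A} (hμ : IsLeftIntegral K μ) (h y : A) :
    TensorProduct.rid K A (LinearMap.lTensor A μ (((1 : A) ⊗ₜ[K] h) * comul y)) =
      TensorProduct.rid K A (TensorProduct.map (antipode K) (μ ∘ₗ LinearMap.mulRight K y)
        (comul h)) := by
  -- Again 1 ⊗ h = ∑ (S(h₁) ⊗ 1) Δ(h₂); now Δ(h₂) Δ(y) = Δ(h₂ y) and the integral property applies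
  -- to h₂ y.
  rw [← _root_.antipode_tmul_one_mul_comul h]
  generalize comul (R := K) h = t
  induction t with
  | zero => simp
  | add x y hx hy => simp only [map_add, add_mul, hx, hy]
  | tmul p q =>
    simp only [TensorProduct.map_tmul, LinearMap.mul'_apply, mul_assoc, ← Bialgebra.comul_mul]
    have h1 : ∀ t : A ⊗[K] A, TensorProduct.rid K A (LinearMap.lTensor A μ
        ((antipode K p ⊗ₜ[K] (1 : A)) * t)) =
        antipode K p * TensorProduct.rid K A (LinearMap.lTensor A μ t) := by
      intro t
      induction t with
      | zero => simp
      | add x y hx hy => simp only [map_add, mul_add, hx, hy]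
      | tmul x y => simp
    refine (h1 _).trans ?_
    rw [hμ]
    simp

theorem rid_lTensor_one_tmul_mul (μ : Module.Dual K A) (h : A) (t : A ⊗[K] A) :
    TensorProduct.rid K A (LinearMap.lTensor A μ (((1 : A) ⊗ₜ[K] h) * t)) =
      TensorProduct.rid K A (LinearMap.lTensor A (μ ∘ₗ LinearMap.mulLeft K h) t) := by
  induction t with
  | zero => simp
  | add x y hx hy => simp only [map_add, mul_add, hx, hy]
  | tmul x y => simp

theorem rid_lTensor_tmul_one_mul (μ : Module.Dual K A) (h : A) (t : A ⊗[K] A) :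
    TensorProduct.rid K A (LinearMap.lTensor A μ ((h ⊗ₜ[K] (1 : A)) * t)) =
      h * TensorProduct.rid K A (LinearMap.lTensor A μ t) := by
  induction t with
  | zero => simp
  | add x y hx hy => simp only [map_add, mul_add, hx, hy]
  | tmul x y => simp

/-! ### Nondegeneracy of integrals and the dual bases they produce. -/

variable [FiniteDimensional K A]

/-- If `∑ p μ(h q) = 0` for all `h`, then `∑ μ(h S(p) q) = 0`. -/
theorem apply_mul_antipode_eq_zero (μ : Module.Dual K A) {t : A ⊗[K] A}
    (ht : ∀ h, TensorProduct.rid K A (LinearMap.lTensor A (μ ∘ₗ LinearMap.mulLeft K h) t) = 0)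
    (h : A) : μ (h * LinearMap.mul' K A (LinearMap.rTensor A (antipode K) t)) = 0 := by
  let b := Module.finBasis K A
  -- Expanding p in the basis bᵢ turns μ(h S(p) q) into a sum of coordinates of p μ(h S(bᵢ) q), each
  -- an instance of the hypothesis.
  have h1 : ∀ s : A ⊗[K] A, μ (h * LinearMap.mul' K A (LinearMap.rTensor A (antipode K) s)) =
      ∑ i, b.coord i (TensorProduct.rid K A
        (LinearMap.lTensor A (μ ∘ₗ LinearMap.mulLeft K (h * antipode K (b i))) s)) := by
    intro s
    induction s with
    | zero => simp
    | add x y hx hy => simp only [map_add, mul_add, hx, hy, Finset.sum_add_distrib]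
    | tmul x y =>
      simp only [LinearMap.rTensor_tmul, LinearMap.mul'_apply, LinearMap.lTensor_tmul]
      have h2 : antipode K x = ∑ i, b.repr x i • antipode K (b i) := by
        simp only [← map_smul, ← map_sum, b.sum_repr]
      rw [h2]
      simp [Finset.mul_sum, Finset.sum_mul, mul_comm]
  rw [h1]
  simp only [ht, map_zero, Finset.sum_const_zero]

/-- A nonzero left integral is nondegenerate. -/
theorem IsLeftIntegral.eq_zero_of_forall_mul {μ : Module.Dual K A} (hμ : IsLeftIntegral K μ)
    (h0 : μ ≠ 0) {y : A} (hy : ∀ h, μ (h * y) = 0) : y = 0 := by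
  have key : ∀ y : A, (∀ h, μ (h * y) = 0) → ∀ h,
      TensorProduct.rid K A (LinearMap.lTensor A (μ ∘ₗ LinearMap.mulLeft K h) (comul y)) = 0 := by
    intro y hy h
    rw [← rid_lTensor_one_tmul_mul, hμ.lTensor_mul_comul]
    have : μ ∘ₗ LinearMap.mulRight K y = 0 := LinearMap.ext hy
    rw [this]
    simp
  -- Contracting `key` with the antipode gives μ(h S(y₁) y₂) = ε(y) μ(h) = 0 for all h, and μ ≠ 0.
  have hε : ∀ y : A, (∀ h, μ (h * y) = 0) → counit (R := K) y = 0 := by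
    intro y hy
    by_contra hne
    refine h0 (LinearMap.ext fun h => ?_)
    have h1 := apply_mul_antipode_eq_zero μ (key y hy) h
    rw [mul_antipode_rTensor_comul_apply, Algebra.algebraMap_eq_smul_one, mul_smul_comm, map_smul,
      mul_one, smul_eq_mul] at h1
    exact (mul_eq_zero.1 h1).resolve_left hne
  refine (Module.forall_dual_apply_eq_zero_iff K y).1 fun f => ?_
  -- By `key`, the annihilated elements are stable under y ↦ ∑ f(y₁) y₂; since ε of this element is
  -- f(y), every linear form kills y.
  have h2 := hε (TensorProduct.lid K A (LinearMap.rTensor A f (comul y))) fun h => by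
    have h3 : ∀ t : A ⊗[K] A, μ (h * TensorProduct.lid K A (LinearMap.rTensor A f t)) =
        f (TensorProduct.rid K A (LinearMap.lTensor A (μ ∘ₗ LinearMap.mulLeft K h) t)) := by
      intro t
      induction t with
      | zero => simp
      | add x y hx hy => simp only [map_add, mul_add, hx, hy]
      | tmul x y => simp [mul_comm]
    rw [h3, key y hy, map_zero]
  have h4 : ∀ t : A ⊗[K] A, counit (R := K) (TensorProduct.lid K A (LinearMap.rTensor A f t)) =
      f (TensorProduct.rid K A (LinearMap.lTensor A counit t)) := by
    intro t
    induction t with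
    | zero => simp
    | add x y hx hy => simp only [map_add, hx, hy]
    | tmul x y => simp [mul_comm]
  rw [h4] at h2
  simpa using h2

/-- A nonzero left integral does not vanish on a nonzero left cointegral. -/
theorem IsLeftIntegral.apply_ne_zero {μ : Module.Dual K A} (hμ : IsLeftIntegral K μ)
    (h0 : μ ≠ 0) {Λ : A} (hΛ : IsLeftCointegral K Λ) (hΛ0 : Λ ≠ 0) : μ Λ ≠ 0 := by
  intro h
  refine hΛ0 ((Module.forall_dual_apply_eq_zero_iff K Λ).1 fun f => ?_)
  -- If μ(Λ) = 0 then ∑ Λ₁ μ(h Λ₂) = S(h) ∑ Λ₁ μ(Λ₂) = S(h) μ(Λ) = 0, so nondegeneracy kills ∑ f(Λ₁)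
  -- Λ₂; its counit is f(Λ).
  have h1 : TensorProduct.lid K A (LinearMap.rTensor A f (comul Λ)) = 0 := by
    refine hμ.eq_zero_of_forall_mul h0 fun h' => ?_
    have h3 : ∀ t : A ⊗[K] A, μ (h' * TensorProduct.lid K A (LinearMap.rTensor A f t)) =
        f (TensorProduct.rid K A (LinearMap.lTensor A (μ ∘ₗ LinearMap.mulLeft K h') t)) := by
      intro t
      induction t with
      | zero => simp
      | add x y hx hy => simp only [map_add, mul_add, hx, hy]
      | tmul x y => simp [mul_comm]
    rw [h3, ← rid_lTensor_one_tmul_mul, ← hΛ.antipode_tmul_one_mul_comul, rid_lTensor_tmul_one_mul,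
      hμ, h]
    simp
  have h4 : ∀ t : A ⊗[K] A, counit (R := K) (TensorProduct.lid K A (LinearMap.rTensor A f t)) =
      f (TensorProduct.rid K A (LinearMap.lTensor A counit t)) := by
    intro t
    induction t with
    | zero => simp
    | add x y hx hy => simp only [map_add, hx, hy]
    | tmul x y => simp [mul_comm]
  have h5 := h4 (comul Λ)
  rw [h1] at h5
  simpa using h5.symm

variable [InvertibleAntipode K A]

/-- `h = ∑ μ(h Λ₂) S⁻¹(Λ₁)` if `μ(Λ) = 1`. -/
theorem IsLeftIntegral.sum_antipodeInv {μ : Module.Dual K A} (hμ : IsLeftIntegral K μ) {Λ : A}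
    (hΛ : IsLeftCointegral K Λ) (h1 : μ Λ = 1) (h : A) :
    TensorProduct.rid K A (TensorProduct.map (antipodeInv K A) (μ ∘ₗ LinearMap.mulLeft K h)
      (comul Λ)) = h := by
  apply (InvertibleAntipode.bijective (K := K) (A := A)).1
  have h3 : ∀ t : A ⊗[K] A, antipode K (TensorProduct.rid K A (TensorProduct.map (antipodeInv K A)
      (μ ∘ₗ LinearMap.mulLeft K h) t)) =
      TensorProduct.rid K A (LinearMap.lTensor A (μ ∘ₗ LinearMap.mulLeft K h) t) := by
    intro t
    induction t with
    | zero => simp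
    | add x y hx hy => simp only [map_add, hx, hy]
    | tmul x y => simp
  -- After S is applied, the sum is ∑ Λ₁ μ(h Λ₂) = S(h) ∑ Λ₁ μ(Λ₂) = S(h) μ(Λ).
  rw [h3, ← rid_lTensor_one_tmul_mul, ← hΛ.antipode_tmul_one_mul_comul, rid_lTensor_tmul_one_mul,
    hμ, h1]
  simp

/-- The canonical element of `A ⊗ A*` is `∑ S⁻¹(Λ₁) ⊗ μ(· Λ₂)` if `μ(Λ) = 1`. -/
theorem IsLeftIntegral.coevaluation_eq {μ : Module.Dual K A} (hμ : IsLeftIntegral K μ) {Λ : A}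
    (hΛ : IsLeftCointegral K Λ) (h1 : μ Λ = 1) :
    coevaluation K A (1 : K) = TensorProduct.map (antipodeInv K A)
      ((LinearMap.mul K A).flip.compr₂ μ) (comul Λ) := by
  -- Under A* ⊗ A ≅ End(A) the canonical element is the identity, and so is the right-hand side by
  -- `sum_antipodeInv`.
  apply (TensorProduct.comm K A (Module.Dual K A)).injective
  apply (dualTensorHomEquiv K A A).injective
  ext h
  have h3 : ∀ t : A ⊗[K] A, dualTensorHom K A A (TensorProduct.comm K A (Module.Dual K A)
      (TensorProduct.map (antipodeInv K A) ((LinearMap.mul K A).flip.compr₂ μ) t)) h =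
      TensorProduct.rid K A (TensorProduct.map (antipodeInv K A) (μ ∘ₗ LinearMap.mulLeft K h)
      t) := by
    intro t
    induction t with
    | zero => simp
    | add x y hx hy => simp only [map_add, LinearMap.add_apply, hx, hy]
    | tmul x y => simp
  refine Eq.trans ?_ ((h3 _).trans (hμ.sum_antipodeInv hΛ h1 h)).symm
  change dualTensorHom K A A _ h = h
  rw [coevaluation_apply_one]
  refine Eq.trans ?_ ((Module.Basis.ofVectorSpace K A).sum_repr h)
  simp

end Convolution

/-! ### Iterated coproducts and the hit actions. -/

section Sweedler

variable {K A : Type*} [Field K] [Ring A] [HopfAlgebra K A]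

/-- `p ⊗ (q ⊗ r) ↦ φ(r) ⊗ (φ(q) ⊗ φ(p))`. -/
def revMap (φ : A →ₗ[K] A) : A ⊗[K] (A ⊗[K] A) →ₗ[K] A ⊗[K] (A ⊗[K] A) :=
  TensorProduct.map φ (TensorProduct.map φ φ) ∘ₗ
    LinearMap.lTensor A (TensorProduct.comm K A A).toLinearMap ∘ₗ
    (TensorProduct.comm K (A ⊗[K] A) A).toLinearMap ∘ₗ
    (TensorProduct.assoc K A A A).symm.toLinearMap

@[simp] theorem revMap_tmul (φ : A →ₗ[K] A) (p q r : A) :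
    revMap φ (p ⊗ₜ (q ⊗ₜ r)) = φ r ⊗ₜ (φ q ⊗ₜ φ p) := by
  simp [revMap]

/-- Stated for an arbitrary anticomultiplicative map so that it serves both S (for û) and S⁻¹ (for
u). -/
theorem comul₂_of_anticomultiplicative {φ : A →ₗ[K] A}
    (hφ : ∀ a, comul (R := K) (φ a) = TensorProduct.map φ φ (TensorProduct.comm K A A (comul a)))
    (a : A) : comul₂ K A (φ a) = revMap φ (comul₂ K A a) := by
  rw [comul₂, LinearMap.comp_apply, LinearMap.comp_apply, hφ, ← Coalgebra.coassoc_apply]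
  generalize comul (R := K) a = t
  induction t with
  | zero => simp
  | add x y hx hy => simp only [map_add, hx, hy]
  | tmul x y =>
    simp only [TensorProduct.comm_tmul, TensorProduct.map_tmul, LinearMap.lTensor_tmul, hφ,
      LinearMap.rTensor_tmul]
    generalize comul (R := K) x = s
    induction s with
    | zero => simp
    | add x y hx hy => simp only [map_add, TensorProduct.add_tmul, TensorProduct.tmul_add, hx, hy]
    | tmul x y => simp

/-- `(x₁ ⊗ (x₂ ⊗ x₃)) ⊗ x₄ = x₁ ⊗ (x₂ ⊗ (x₃ ⊗ x₄))`. -/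
theorem rTensor_comul₂_comul (x : A) :
    TensorProduct.map LinearMap.id (TensorProduct.assoc K A A A).toLinearMap
      (TensorProduct.assoc K A (A ⊗[K] A) A (LinearMap.rTensor A (comul₂ K A) (comul x))) =
      LinearMap.lTensor A (comul₂ K A) (comul x) := by
  have : TensorProduct.map LinearMap.id (TensorProduct.assoc K A A A).toLinearMap ∘ₗ
      (TensorProduct.assoc K A (A ⊗[K] A) A).toLinearMap ∘ₗ
      LinearMap.rTensor A (comul₂ K A) ∘ₗ comul = LinearMap.lTensor A (comul₂ K A) ∘ₗ comul := by
    simp only [comul₂, coassoc_simps]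
  exact congr($this x)

/-- The hits are transposes of convolution multiplications, here on the left and in `apply_leftHit`
on the right. This is how ad*(γ) on A becomes a conjugation on A°. -/
theorem apply_rightHit (f g : OpDual K A) (y : A) : f (rightHit g y) = (g * f) y := by
  simp only [rightHit, LinearMap.comp_apply, OpDual.mul_apply, LinearEquiv.coe_coe]
  generalize comul (R := K) y = t
  induction t with
  | zero => simp
  | add x y hx hy => simp only [map_add, hx, hy]
  | tmul p q => simp

theorem apply_leftHit (f g : OpDual K A) (y : A) : f (leftHit g y) = (f * g) y := by
  simp only [leftHit, LinearMap.comp_apply, OpDual.mul_apply, LinearEquiv.coe_coe]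
  generalize comul (R := K) y = t
  induction t with
  | zero => simp
  | add x y hx hy => simp only [map_add, hx, hy]
  | tmul p q => simp [mul_comm]

end Sweedler

/-! ### The double as a space of endomorphisms of A. -/

namespace DrinfeldDouble

variable {K A : Type*} [Field K] [Ring A] [HopfAlgebra K A] [FiniteDimensional K A]
  [InvertibleAntipode K A]

variable (A) in
/-- The value at `x` of the endomorphism of `A` attached to an element of `D(A) = A° ⊗ A`. -/
def ev (x : A) : DrinfeldDouble K A →ₗ[K] A :=
  OpDual.evL A x ∘ₗ (ofTensor K A).symm.toLinearMap

@[simp] theorem ev_mk (x : A) (f : OpDual K A) (a : A) :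
    ev A x (inclDual K A f * inclA K A a) = f x • a := by
  rw [← ofTensor_tmul]
  simp [ev]

/-- Finite dimension makes A° ⊗ A → End(A) injective, so identities in D(A) can be checked as
identities of endomorphisms of A. -/
theorem ev_ext {y z : DrinfeldDouble K A} (h : ∀ x, ev A x y = ev A x z) : y = z :=
  (ofTensor K A).symm.injective (OpDual.ext_evL h)

/-- The commutation rule as an endomorphism: x ↦ ∑ f(S⁻¹(a₃) x a₁) a₂. The order of the arguments
comes from the opposite comultiplication of A°, and S⁻¹ from its antipode. -/
theorem ev_inclA_mul_inclDual (x a : A) (f : OpDual K A) :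
    ev A x (inclA K A a * inclDual K A f) = OpDual.sandM A x f (comul₂ K A a) := by
  rw [inclA_mul_inclDual, ← OpDual.evL_bowtie_eq]
  simp [ev]

theorem ev_inclDual_mul (x : A) (f : OpDual K A) (z : DrinfeldDouble K A) :
    ev A x (inclDual K A f * z) = ∑ i ∈ (ℛ K x).index, f ((ℛ K x).left i) •
      ev A ((ℛ K x).right i) z := by
  induction z using induction with
  | h0 => simp
  | hadd x y hx hy => simp only [mul_add, map_add, hx, hy, smul_add, Finset.sum_add_distrib]
  | hmul g b =>
    rw [← mul_assoc, ← map_mul, ev_mk, OpDual.mul_apply]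
    conv_lhs => rw [← (ℛ K x).eq]
    simp [Finset.sum_smul, mul_smul]

theorem ev_inclA_mul (x a : A) (z : DrinfeldDouble K A) :
    ev A x (inclA K A a * z) = OpDual.sand x (comul₂ K A a) ((ofTensor K A).symm z) := by
  rw [← OpDual.evL_bowtieMul_right]
  rfl

theorem sand_tmul_apply (x p q r : A) (z : DrinfeldDouble K A) :
    OpDual.sand x (p ⊗ₜ (q ⊗ₜ r)) ((ofTensor K A).symm z) =
      q * ev A (antipodeInv K A r * (x * p)) z := by
  induction z using induction with
  | h0 => simp
  | hadd x y hx hy => simp only [map_add, mul_add, hx, hy]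
  | hmul f m => rw [ev_mk, ← ofTensor_tmul]; simp

/-- The value at `x` of the product with `z`, in terms of `w₁ ⊗ (w₂ ⊗ w₃) ⊗ x₂` for
`w = ev x₁ y`. -/
theorem ev_mul (x : A) (y z : DrinfeldDouble K A) :
    ev A x (y * z) = ∑ i ∈ (ℛ K x).index, OpDual.sand ((ℛ K x).right i)
      (comul₂ K A (ev A ((ℛ K x).left i) y)) ((ofTensor K A).symm z) := by
  induction y using induction with
  | h0 => simp
  | hadd x y hx hy =>
    simp only [add_mul, map_add, hx, hy, LinearMap.add_apply, Finset.sum_add_distrib]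
  | hmul f a =>
    rw [mul_assoc, ev_inclDual_mul]
    simp [ev_inclA_mul]

theorem antipode_inclDual (f : OpDual K A) :
    antipode K (inclDual K A f) = inclDual K A (antipode K f) := by
  have := doubleAntipode_mk f (1 : A)
  change doubleAntipode K A _ = _
  simpa using this

theorem antipode_inclA (a : A) :
    antipode K (inclA K A a) = inclA K A (antipode K a) := by
  have := doubleAntipode_mk (1 : OpDual K A) a
  change doubleAntipode K A _ = _
  simpa using this

/-- Since S(fᵢ) = fᵢ ∘ S⁻¹, the sum ∑ fᵢ(S⁻¹(x)) eᵢ is the basis expansion of S⁻¹(x). -/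
theorem ev_drinfeldElement (x : A) :
    ev A x (drinfeldElement (universalR K A)) = antipodeInv K A x := by
  simp only [drinfeldElement, universalR, coevaluation_apply_one, map_sum]
  simp only [TensorProduct.map_tmul, TensorProduct.comm_tmul, LinearMap.rTensor_tmul,
    LinearMap.mul'_apply, AlgHom.toLinearMap_apply, LinearMap.comp_apply, antipode_inclDual, ev_mk]
  refine Eq.trans ?_ ((Module.Basis.ofVectorSpace K A).sum_repr (antipodeInv K A x))
  simp

end DrinfeldDouble

/-! ### The modulus and the comodulus are group-like. -/

section Modulus

variable {K A : Type*} [Field K] [Ring A] [HopfAlgebra K A]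

theorem IsModulus.map_one {α : OpDual K A} (hα : IsModulus K α) : α 1 = 1 := by
  obtain ⟨Λ, h0, -, h⟩ := hα
  have h1 := h 1
  rw [mul_one] at h1
  exact smul_left_injective K h0 (by simpa using h1.symm)

theorem IsModulus.map_mul {α : OpDual K A} (hα : IsModulus K α) (x y : A) :
    α (x * y) = α x * α y := by
  obtain ⟨Λ, h0, -, h⟩ := hα
  refine smul_left_injective K h0 ?_
  change α (x * y) • Λ = (α x * α y) • Λ
  rw [← h, ← mul_assoc, h, smul_mul_assoc, h, smul_smul]

/-- Group-likes of A° are the characters of A; the opposite comultiplication makes no difference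
because K is commutative. -/
theorem OpDual.isGroupLikeElem_iff [FiniteDimensional K A] {f : OpDual K A} :
    IsGroupLikeElem K f ↔ f 1 = 1 ∧ ∀ x y, f (x * y) = f x * f y := by
  constructor
  · intro hf
    refine ⟨hf.counit_eq_one, fun x y => ?_⟩
    rw [← OpDual.pair_comul_tmul, hf.comul_eq_tmul_self, OpDual.pair_tmul, mul_comm]
  · rintro ⟨h1, h2⟩
    refine ⟨h1, OpDual.ext_pair fun x y => ?_⟩
    rw [OpDual.pair_comul_tmul, OpDual.pair_tmul, h2, mul_comm]

theorem IsModulus.isGroupLikeElem [FiniteDimensional K A] {α : OpDual K A} (hα : IsModulus K α) :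
    IsGroupLikeElem K α :=
  OpDual.isGroupLikeElem_iff.2 ⟨hα.map_one, hα.map_mul⟩

theorem IsComodulus.isGroupLikeElem {a : A} (ha : IsComodulus K a) : IsGroupLikeElem K a := by
  obtain ⟨μ, h0, -, hμ⟩ := ha
  obtain ⟨h, hh⟩ : ∃ h, μ h ≠ 0 := by
    by_contra! hne
    exact h0 (LinearMap.ext hne)
  constructor
  · have h1 := congr(counit (R := K) $(hμ h))
    have h2 : ∀ t : A ⊗[K] A, counit (R := K) (TensorProduct.lid K A (LinearMap.rTensor A μ t)) =
        μ (TensorProduct.rid K A (LinearMap.lTensor A counit t)) := by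
      intro t
      induction t with
      | zero => simp
      | add x y hx hy => simp only [map_add, hx, hy]
      | tmul x y => simp [mul_comm]
    rw [h2] at h1
    simp only [lTensor_counit_comul, TensorProduct.rid_tmul, one_smul, map_smul,
      smul_eq_mul] at h1
    exact mul_left_cancel₀ hh (by rw [← h1, mul_one])
  -- By coassociativity μ(h) Δ(a) = ∑ μ(h₁) h₂ ⊗ h₃ = ∑ a ⊗ μ(h₁) h₂ = μ(h) a ⊗ a, and μ(h) ≠ 0.
  · have h1 := congr(comul (R := K) $(hμ h))
    have h2 : ∀ t : A ⊗[K] A, comul (R := K) (TensorProduct.lid K A (LinearMap.rTensor A μ t)) =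
        TensorProduct.lid K (A ⊗[K] A) (LinearMap.rTensor (A ⊗[K] A) μ
          (LinearMap.lTensor A comul t)) := by
      intro t
      induction t with
      | zero => simp
      | add x y hx hy => simp only [map_add, hx, hy]
      | tmul x y => simp
    have h3 : ∀ t : A ⊗[K] A, TensorProduct.lid K (A ⊗[K] A) (LinearMap.rTensor (A ⊗[K] A) μ
        (TensorProduct.assoc K A A A (LinearMap.rTensor A comul t))) =
        a ⊗ₜ TensorProduct.lid K A (LinearMap.rTensor A μ t) := by
      intro t
      induction t with
      | zero => simp
      | add x y hx hy => simp only [map_add, hx, hy, TensorProduct.tmul_add]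
      | tmul x y =>
        have h4 : ∀ s : A ⊗[K] A, TensorProduct.lid K (A ⊗[K] A) (LinearMap.rTensor (A ⊗[K] A) μ
            (TensorProduct.assoc K A A A (s ⊗ₜ y))) =
            TensorProduct.lid K A (LinearMap.rTensor A μ s) ⊗ₜ y := by
          intro s
          induction s with
          | zero => simp
          | add x y hx hy => simp only [map_add, hx, hy, TensorProduct.add_tmul]
          | tmul p q => simp [TensorProduct.smul_tmul']
        rw [LinearMap.rTensor_tmul, h4, hμ]
        simp [TensorProduct.smul_tmul]
    rw [h2, ← Coalgebra.coassoc_apply, h3, hμ, TensorProduct.tmul_smul, map_smul] at h1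
    exact (smul_right_injective _ hh h1).symm

theorem IsLeftCointegral.smul {Λ : A} (hΛ : IsLeftCointegral K Λ) (c : K) :
    IsLeftCointegral K (c • Λ) := by
  intro h
  rw [mul_smul_comm, hΛ, smul_comm]

end Modulus

/-! ### The canonical element of the double. -/

namespace DrinfeldDouble

variable {K A : Type*} [Field K] [Ring A] [HopfAlgebra K A] [FiniteDimensional K A]
  [InvertibleAntipode K A]

/-- `p ⊗ (z ⊗ (q ⊗ r)) ↦ μ(p x S(q) r) S(z)`. -/
def hatContraction (μ : Module.Dual K A) (x : A) : A ⊗[K] (A ⊗[K] (A ⊗[K] A)) →ₗ[K] A :=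
  (TensorProduct.rid K A).toLinearMap ∘ₗ TensorProduct.map (antipode K)
      (μ ∘ₗ LinearMap.mul' K A ∘ₗ TensorProduct.map (LinearMap.mulRight K x)
        (LinearMap.mul' K A ∘ₗ LinearMap.rTensor A (antipode K))) ∘ₗ
    (TensorProduct.leftComm K A A (A ⊗[K] A)).toLinearMap

@[simp] theorem hatContraction_tmul (μ : Module.Dual K A) (x p z : A) (s : A ⊗[K] A) :
    hatContraction μ x (p ⊗ₜ (z ⊗ₜ s)) =
      μ (p * x * LinearMap.mul' K A (LinearMap.rTensor A (antipode K) s)) • antipode K z := by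
  simp [hatContraction]

/-- The pair S(z₂) z₃ inside μ collapses to a counit, so μ(p x S(z₂) z₃) S(z₁) becomes μ(p x) S(z).
-/
theorem hatContraction_lTensor_comul₂ (μ : Module.Dual K A) (x : A) (t : A ⊗[K] A) :
    hatContraction μ x (LinearMap.lTensor A (comul₂ K A) t) =
      TensorProduct.lid K A (TensorProduct.map μ (antipode K) (t * (x ⊗ₜ[K] (1 : A)))) := by
  induction t with
  | zero => simp
  | add x y hx hy => simp only [map_add, add_mul, hx, hy]
  | tmul p z =>
    have h1 : ∀ s : A ⊗[K] A, hatContraction μ x (p ⊗ₜ (LinearMap.lTensor A comul s)) =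
        μ (p * x) • antipode K (TensorProduct.rid K A (LinearMap.lTensor A counit s)) := by
      intro s
      induction s with
      | zero => simp
      | add x y hx hy => simp only [map_add, TensorProduct.tmul_add, smul_add, hx, hy]
      | tmul q r =>
        rw [LinearMap.lTensor_tmul, hatContraction_tmul, mul_antipode_rTensor_comul_apply]
        simp [Algebra.algebraMap_eq_smul_one, smul_smul, mul_comm]
    rw [LinearMap.lTensor_tmul, comul₂, LinearMap.comp_apply, h1]
    simp

/-- S reverses the coproduct of p, and the S⁻¹ in the commutation rule cancels the S on p₁: the
value is ∑ μ(p₁ x S(p₃) q) S(p₂). For p ⊗ q = Δ(Λ) the factor S(p₃) q then collapses. -/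
theorem ev_inclA_antipode_mul_inclDual (μ : Module.Dual K A) (x p q : A) :
    ev A x (inclA K A (antipode K p) *
      inclDual K A ((OpDual.toDual K A).symm ((LinearMap.mul K A).flip.compr₂ μ q))) =
    hatContraction μ x (TensorProduct.map LinearMap.id (TensorProduct.assoc K A A A).toLinearMap
      (TensorProduct.assoc K A (A ⊗[K] A) A (comul₂ K A p ⊗ₜ q))) := by
  rw [ev_inclA_mul_inclDual, comul₂_of_anticomultiplicative (comul_antipode_eq K)]
  generalize comul₂ K A p = t
  induction t with
  | zero => simp
  | add x y hx hy => simp only [map_add, TensorProduct.add_tmul, hx, hy]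
  | tmul p t =>
  induction t with
  | zero => simp
  | add x y hx hy =>
    simp only [map_add, TensorProduct.tmul_add, TensorProduct.add_tmul, hx, hy]
  | tmul z r => simp [mul_assoc]

/-- With dual bases taken from Λ and μ, the value is ∑ μ(Λ₁ x) S(Λ₂). The modulus turns it into ∑
μ(Λ₁) S(Λ₂ S(x ↼ α)), and the comodulus gives ∑ μ(Λ₁) Λ₂ = a. -/
theorem ev_drinfeldElementHat {α : OpDual K A} {a : A} {Λ : A} {μ : Module.Dual K A}
    (hΛ : IsLeftCointegral K Λ) (hα : ∀ h, Λ * h = α h • Λ) (hμ : IsLeftIntegral K μ)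
    (ha : ∀ h : A, TensorProduct.lid K A (LinearMap.rTensor A μ (comul h)) = μ h • a)
    (h1 : μ Λ = 1) (x : A) :
    ev A x (drinfeldElementHat (universalR K A)) =
      antipode K (antipode K (rightHit α x)) * antipode K a := by
  have h2 : ∀ t : A ⊗[K] A, ev A x (LinearMap.mul' K _ (LinearMap.rTensor _
      (antipode K ∘ₗ antipode K) (TensorProduct.map (inclA K A).toLinearMap
        ((inclDual K A).toLinearMap ∘ₗ (OpDual.toDual K A).symm.toLinearMap)
        (TensorProduct.map (antipodeInv K A) ((LinearMap.mul K A).flip.compr₂ μ) t)))) =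
      hatContraction μ x (TensorProduct.map LinearMap.id (TensorProduct.assoc K A A A).toLinearMap
        (TensorProduct.assoc K A (A ⊗[K] A) A (LinearMap.rTensor A (comul₂ K A) t))) := by
    intro t
    induction t with
    | zero => simp
    | add x y hx hy => simp only [map_add, hx, hy]
    | tmul p q =>
      rw [LinearMap.rTensor_tmul, ← ev_inclA_antipode_mul_inclDual]
      simp only [TensorProduct.map_tmul, LinearMap.rTensor_tmul, LinearMap.mul'_apply,
        AlgHom.toLinearMap_apply, LinearMap.comp_apply, antipode_inclA, antipode_antipodeInv,
        LinearEquiv.coe_coe]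
  have h3 : ∀ (z : A) (t : A ⊗[K] A), TensorProduct.lid K A (TensorProduct.map μ (antipode K)
      (t * ((1 : A) ⊗ₜ[K] antipode K z))) = antipode K (antipode K z) *
        antipode K (TensorProduct.lid K A (LinearMap.rTensor A μ t)) := by
    intro z t
    induction t with
    | zero => simp
    | add x y hx hy => simp only [map_add, add_mul, mul_add, hx, hy]
    | tmul p q => simp [antipode_mul_antidistrib]
  have h4 := h3 (rightHit α x) (comul Λ)
  rw [ha, h1, one_smul] at h4
  rw [← h4, drinfeldElementHat, universalR, hμ.coevaluation_eq hΛ h1, h2,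
    rTensor_comul₂_comul, hatContraction_lTensor_comul₂]
  exact congr(TensorProduct.lid K A (TensorProduct.map μ (antipode K)
    $(comul_mul_tmul_one (α := OpDual.toDual K A α) hα x)))

/-- `p ⊗ (z ⊗ (q ⊗ r)) ↦ S⁻¹(z) F(S⁻²(p) r S⁻¹(q))`. -/
def drinfeldContraction (F : A →ₗ[K] A) : A ⊗[K] (A ⊗[K] (A ⊗[K] A)) →ₗ[K] A :=
  LinearMap.mul' K A ∘ₗ TensorProduct.map (antipodeInv K A)
      (F ∘ₗ LinearMap.mul' K A ∘ₗ TensorProduct.map (antipodeInv K A ∘ₗ antipodeInv K A)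
        (LinearMap.mul' K A ∘ₗ (TensorProduct.comm K A A).toLinearMap ∘ₗ
          LinearMap.rTensor A (antipodeInv K A))) ∘ₗ
    (TensorProduct.leftComm K A A (A ⊗[K] A)).toLinearMap

@[simp] theorem drinfeldContraction_tmul (F : A →ₗ[K] A) (p z : A) (s : A ⊗[K] A) :
    drinfeldContraction F (p ⊗ₜ (z ⊗ₜ s)) =
      antipodeInv K A z * F (antipodeInv K A (antipodeInv K A p) * LinearMap.mul' K A
        (TensorProduct.comm K A A (LinearMap.rTensor A (antipodeInv K A) s))) := by
  simp [drinfeldContraction]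

theorem drinfeldContraction_lTensor_comul₂ (F : A →ₗ[K] A) (t : A ⊗[K] A) :
    drinfeldContraction F (LinearMap.lTensor A (comul₂ K A) t) =
      LinearMap.mul' K A (TensorProduct.comm K A A (TensorProduct.map
        (F ∘ₗ antipodeInv K A ∘ₗ antipodeInv K A) (antipodeInv K A) t)) := by
  induction t with
  | zero => simp
  | add x y hx hy => simp only [map_add, hx, hy]
  | tmul p z =>
    have h1 : ∀ s : A ⊗[K] A, drinfeldContraction F (p ⊗ₜ (LinearMap.lTensor A comul s)) =
        antipodeInv K A (TensorProduct.rid K A (LinearMap.lTensor A counit s)) *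
          F (antipodeInv K A (antipodeInv K A p)) := by
      intro s
      induction s with
      | zero => simp
      | add x y hx hy => simp only [map_add, TensorProduct.tmul_add, add_mul, hx, hy]
      | tmul q r =>
        rw [LinearMap.lTensor_tmul, drinfeldContraction_tmul, mul_antipodeInv_left]
        simp
    rw [LinearMap.lTensor_tmul, comul₂, LinearMap.comp_apply, h1]
    simp

/-- As u acts by S⁻¹, which reverses coproducts, the product takes x to ∑ S⁻¹(x₂) F(S⁻²(x₁) x₄
S⁻¹(x₃)). The factor x₄ S⁻¹(x₃) collapses and ∑ S⁻¹(x₂) F(S⁻²(x₁)) remains. -/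
theorem ev_drinfeldElement_mul (x : A) (v : DrinfeldDouble K A) {F : A →ₗ[K] A}
    (hv : ∀ x, ev A x v = F x) :
    ev A x (drinfeldElement (universalR K A) * v) =
      LinearMap.mul' K A (TensorProduct.comm K A A (TensorProduct.map
        (F ∘ₗ antipodeInv K A ∘ₗ antipodeInv K A) (antipodeInv K A) (comul x))) := by
  rw [← drinfeldContraction_lTensor_comul₂, ← rTensor_comul₂_comul, ev_mul]
  conv_rhs => rw [← (ℛ K x).eq]
  simp only [map_sum]
  refine Finset.sum_congr rfl fun i _ => ?_
  rw [ev_drinfeldElement, comul₂_of_anticomultiplicative (comul_antipodeInv K),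
    LinearMap.rTensor_tmul]
  generalize comul₂ K A _ = t
  induction t with
  | zero => simp
  | add x y hx hy => simp only [map_add, TensorProduct.add_tmul, LinearMap.add_apply, hx, hy]
  | tmul p t =>
  induction t with
  | zero => simp
  | add x y hx hy =>
    simp only [map_add, TensorProduct.tmul_add, TensorProduct.add_tmul, LinearMap.add_apply, hx, hy]
  | tmul z r => rw [revMap_tmul, sand_tmul_apply, hv]; simp

/-- A group-like α is fixed by S² of A°, that is, α ∘ S⁻² = α, while S⁻² preserves coproducts. -/
theorem rightHit_antipodeInv_antipodeInv {α : OpDual K A} (hα : IsGroupLikeElem K α) (x : A) :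
    rightHit α (antipodeInv K A (antipodeInv K A x)) =
      antipodeInv K A (antipodeInv K A (rightHit α x)) := by
  have h1 : ∀ y, α (antipodeInv K A (antipodeInv K A y)) = α y := by
    intro y
    rw [← OpDual.antipode_apply, ← OpDual.antipode_apply, hα.antipode_antipode]
  simp only [rightHit, LinearMap.comp_apply, comul_antipodeInv, LinearEquiv.coe_coe]
  generalize comul (R := K) x = t
  induction t with
  | zero => simp
  | add x y hx hy => simp only [map_add, hx, hy]
  | tmul p q => simp [h1]

/-- `∑ S⁻¹(x₃) x₂ α(x₁) = α(x)`. -/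
theorem mul_antipodeInv_rightHit (α : OpDual K A) (x : A) :
    LinearMap.mul' K A (TensorProduct.comm K A A (TensorProduct.map
        (rightHit α) (antipodeInv K A) (comul x))) = α x • 1 := by
  have h1 : ∀ t : A ⊗[K] A, LinearMap.mul' K A (TensorProduct.comm K A A (TensorProduct.map
        (rightHit α) (antipodeInv K A) t)) =
      LinearMap.mul' K A (TensorProduct.comm K A A (LinearMap.lTensor A (antipodeInv K A)
        (TensorProduct.lid K (A ⊗[K] A) (LinearMap.rTensor (A ⊗[K] A) (OpDual.toDual K A α)
          (TensorProduct.assoc K A A A (LinearMap.rTensor A comul t)))))) := by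
    intro t
    induction t with
    | zero => simp
    | add x y hx hy => simp only [map_add, hx, hy]
    | tmul p r =>
      simp only [TensorProduct.map_tmul, LinearMap.rTensor_tmul, rightHit, LinearMap.comp_apply,
        LinearEquiv.coe_coe]
      generalize comul (R := K) p = s
      induction s with
      | zero => simp
      | add x y hx hy => simp only [map_add, TensorProduct.add_tmul, hx, hy]
      | tmul p q => simp
  have h2 : ∀ t : A ⊗[K] A,
      LinearMap.mul' K A (TensorProduct.comm K A A (LinearMap.lTensor A (antipodeInv K A)
        (TensorProduct.lid K (A ⊗[K] A) (LinearMap.rTensor (A ⊗[K] A) (OpDual.toDual K A α)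
          (LinearMap.lTensor A comul t))))) =
      α (TensorProduct.rid K A (LinearMap.lTensor A counit t)) • 1 := by
    intro t
    induction t with
    | zero => simp
    | add x y hx hy => simp only [map_add, add_smul, hx, hy]
    | tmul p r =>
      simp only [LinearMap.lTensor_tmul, LinearMap.rTensor_tmul, TensorProduct.lid_tmul, map_smul,
        mul_antipodeInv_right]
      simp [smul_smul, mul_comm]
  rw [h1, Coalgebra.coassoc_apply, h2]
  simp

theorem drinfeldElement_mul {α : OpDual K A} (hα : IsGroupLikeElem K α) {b : A}
    {v : DrinfeldDouble K A}
    (hv : ∀ x, ev A x v = antipode K (antipode K (rightHit α x)) * b) :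
    drinfeldElement (universalR K A) * v = inclDual K A α * inclA K A b := by
  refine ev_ext fun x => ?_
  -- The S⁻² produced by u cancels the S² in v, leaving ∑ S⁻¹(x₃) x₂ α(x₁) b = α(x) b.
  have h1 : (LinearMap.mulRight K b ∘ₗ antipode K ∘ₗ antipode K ∘ₗ rightHit α) ∘ₗ
      antipodeInv K A ∘ₗ antipodeInv K A = LinearMap.mulRight K b ∘ₗ rightHit α := by
    ext y
    simp [rightHit_antipodeInv_antipodeInv hα]
  rw [ev_drinfeldElement_mul x v
    (F := LinearMap.mulRight K b ∘ₗ antipode K ∘ₗ antipode K ∘ₗ rightHit α) hv, h1, ev_mk]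
  have h2 := congr($(mul_antipodeInv_rightHit α x) * b)
  rw [smul_mul_assoc, one_mul] at h2
  rw [← h2]
  generalize comul (R := K) x = t
  induction t with
  | zero => simp
  | add x y hx hy => simp only [map_add, add_mul, hx, hy]
  | tmul p q => simp [mul_assoc]

theorem canonicalElement_eq {α : OpDual K A} {a : A} (hα : IsModulus K α) (ha : IsComodulus K a) :
    canonicalElement (universalR K A) = inclDual K A α * inclA K A (antipode K a) := by
  obtain ⟨μ, hμ0, hμ, h2⟩ := ha
  have hgl := hα.isGroupLikeElem
  obtain ⟨Λ, hΛ0, hΛ, h3⟩ := hα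
  have h4 := hμ.apply_ne_zero hμ0 hΛ hΛ0
  -- Rescaling Λ by μ(Λ)⁻¹ achieves the normalisation and leaves the modulus unchanged.
  refine drinfeldElement_mul hgl (ev_drinfeldElementHat (hΛ.smul (μ Λ)⁻¹) (fun h => ?_) hμ h2 ?_)
  · rw [smul_mul_assoc, h3, smul_comm]
  · simp [h4]

end DrinfeldDouble

/-! ### Group-like elements of A and of A°. -/

namespace OpDual

variable {K A : Type*} [Field K] [Ring A] [HopfAlgebra K A]

theorem pow_apply_of_isGroupLikeElem (f : OpDual K A) {g : A} (hg : IsGroupLikeElem K g) (n : ℕ) :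
    (f ^ n) g = f g ^ n := by
  induction n with
  | zero => simp [one_apply, hg.counit_eq_one]
  | succ n ih => rw [pow_succ, mul_apply, hg.comul_eq_tmul_self, pair_tmul, ih, pow_succ]

/-- `x ↦ f(S(b) x b)`. -/
def conj (b : A) (f : OpDual K A) : OpDual K A :=
  (toDual K A).symm (toDual K A f ∘ₗ LinearMap.mulLeft K (antipode K b) ∘ₗ LinearMap.mulRight K b)

@[simp] theorem conj_apply (b : A) (f : OpDual K A) (x : A) :
    conj b f x = f (antipode K b * (x * b)) := by
  simp [conj]

end OpDual

theorem adjointAction_of_isGroupLikeElem {K A : Type*} [Field K] [Ring A] [HopfAlgebra K A] {b : A}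
    (hb : IsGroupLikeElem K b) (y : A) : adjointAction K b y = b * y * antipode K b := by
  simp [adjointAction, hb.comul_eq_tmul_self]

/-- Distinct group-likes are linearly independent. Finiteness is what makes ν a root of unity. -/
instance GroupLike.finite {K C : Type*} [Field K] [AddCommGroup C] [Module K C] [Coalgebra K C]
    [FiniteDimensional K C] : Finite (GroupLike K C) :=
  (linearIndep_groupLikeVal (R := K) (A := C)).finite

instance OpDual.finiteDimensional {K A : Type*} [Field K] [Ring A] [HopfAlgebra K A]
    [FiniteDimensional K A] : FiniteDimensional K (OpDual K A) :=
  Module.Finite.equiv (OpDual.toDual K A).symm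

/-! ### Group-like elements of the double. -/

namespace DrinfeldDouble

variable {K A : Type*} [Field K] [Ring A] [HopfAlgebra K A] [FiniteDimensional K A]
  [InvertibleAntipode K A]

theorem isGroupLikeElem_mk {f : OpDual K A} {b : A} (hf : IsGroupLikeElem K f)
    (hb : IsGroupLikeElem K b) : IsGroupLikeElem K (inclDual K A f * inclA K A b) where
  counit_eq_one := by rw [counit_mk, hf.counit_eq_one, hb.counit_eq_one, one_mul]
  comul_eq_tmul_self := by
    rw [comul_mk, hf.comul_eq_tmul_self, hb.comul_eq_tmul_self]
    simp

variable (K A) in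
/-- The projection `id ⊗ ε` of `D(A)` to `A°`. -/
def projDual : DrinfeldDouble K A →ₗ[K] OpDual K A :=
  (TensorProduct.rid K (OpDual K A)).toLinearMap ∘ₗ LinearMap.lTensor (OpDual K A) counit ∘ₗ
    (ofTensor K A).symm.toLinearMap

@[simp] theorem projDual_mk (f : OpDual K A) (b : A) :
    projDual K A (inclDual K A f * inclA K A b) = counit (R := K) b • f := by
  rw [← ofTensor_tmul]
  simp [projDual]

/-- This and the next three lemmas say that the projections id ⊗ ε and ε ⊗ id (the latter being `ev
A 1`) of the tensor product coalgebra are coalgebra maps, so they send group-likes to group-likes.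
-/
theorem counit_projDual (k : DrinfeldDouble K A) :
    counit (R := K) (projDual K A k) = counit (R := K) k := by
  induction k using induction with
  | h0 => simp
  | hadd x y hx hy => simp only [map_add, hx, hy]
  | hmul f a => rw [projDual_mk, counit_mk, map_smul, smul_eq_mul, mul_comm]

theorem counit_ev_one (k : DrinfeldDouble K A) :
    counit (R := K) (ev A 1 k) = counit (R := K) k := by
  induction k using induction with
  | h0 => simp
  | hadd x y hx hy => simp only [map_add, hx, hy]
  | hmul f a => rw [ev_mk, counit_mk, map_smul, smul_eq_mul, OpDual.counit_apply]

theorem comul_projDual (k : DrinfeldDouble K A) :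
    comul (R := K) (projDual K A k) =
      TensorProduct.map (projDual K A) (projDual K A) (comul k) := by
  induction k using induction with
  | h0 => simp
  | hadd x y hx hy => simp only [map_add, hx, hy]
  | hmul f a =>
    have h1 : ∀ (s : OpDual K A ⊗[K] OpDual K A) (t : A ⊗[K] A),
        TensorProduct.map (projDual K A) (projDual K A) (inclDual₂ s * inclA₂ t) =
        counit (R := K) (TensorProduct.rid K A (LinearMap.lTensor A counit t)) • s := by
      intro s t
      induction s with
      | zero => simp
      | add x y hx hy => simp only [map_add, add_mul, smul_add, hx, hy]
      | tmul f g =>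
      induction t with
      | zero => simp
      | add x y hx hy => simp only [map_add, mul_add, add_smul, hx, hy]
      | tmul a b =>
        simp [TensorProduct.smul_tmul', TensorProduct.tmul_smul, smul_smul]
    rw [projDual_mk, comul_mk, h1]
    simp

theorem comul_ev_one (k : DrinfeldDouble K A) :
    comul (R := K) (ev A 1 k) = TensorProduct.map (ev A 1) (ev A 1) (comul k) := by
  induction k using induction with
  | h0 => simp
  | hadd x y hx hy => simp only [map_add, hx, hy]
  | hmul f a =>
    have h1 : ∀ (s : OpDual K A ⊗[K] OpDual K A) (t : A ⊗[K] A),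
        TensorProduct.map (ev A 1) (ev A 1) (inclDual₂ s * inclA₂ t) =
        OpDual.pair s (1 ⊗ₜ 1) • t := by
      intro s t
      induction s with
      | zero => simp
      | add x y hx hy => simp only [map_add, add_mul, LinearMap.add_apply, add_smul, hx, hy]
      | tmul f g =>
      induction t with
      | zero => simp
      | add x y hx hy => simp only [map_add, mul_add, smul_add, hx, hy]
      | tmul a b =>
        simp [TensorProduct.smul_tmul', TensorProduct.tmul_smul, smul_smul, mul_comm]
    rw [ev_mk, comul_mk, h1, OpDual.pair_comul_tmul]
    simp

/-- An element of a tensor product coalgebra is recovered from its coproduct by the two projections;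
for a group-like k this is the factorisation of k. -/
theorem mk_projDual_ev_one (k : DrinfeldDouble K A) :
    ofTensor K A (TensorProduct.map (projDual K A) (ev A 1) (comul k)) = k := by
  induction k using induction with
  | h0 => simp
  | hadd x y hx hy => simp only [map_add, hx, hy]
  | hmul f a =>
    have h1 : ∀ (s : OpDual K A ⊗[K] OpDual K A) (t : A ⊗[K] A),
        TensorProduct.map (projDual K A) (ev A 1) (inclDual₂ s * inclA₂ t) =
        TensorProduct.rid K _ (LinearMap.lTensor _ counit s) ⊗ₜ
          TensorProduct.lid K _ (LinearMap.rTensor _ counit t) := by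
      intro s t
      induction s with
      | zero => simp
      | add x y hx hy => simp only [map_add, add_mul, TensorProduct.add_tmul, hx, hy]
      | tmul f g =>
      induction t with
      | zero => simp
      | add x y hx hy => simp only [map_add, mul_add, TensorProduct.tmul_add, hx, hy]
      | tmul a b =>
        simp [TensorProduct.smul_tmul', TensorProduct.tmul_smul, smul_smul, mul_comm]
    rw [comul_mk, h1]
    simp [ofTensor_tmul]

/-- Group-like elements of `D(A)` are products of group-like elements of `A°` and of `A`. -/
theorem exists_eq_of_isGroupLikeElem {k : DrinfeldDouble K A} (hk : IsGroupLikeElem K k) :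
    ∃ (γ : GroupLike K (OpDual K A)) (b : GroupLike K A),
      k = inclDual K A γ * inclA K A b := by
  refine ⟨⟨projDual K A k, ?_, ?_⟩, ⟨ev A 1 k, ?_, ?_⟩, ?_⟩
  · rw [counit_projDual, hk.counit_eq_one]
  · rw [comul_projDual, hk.comul_eq_tmul_self, TensorProduct.map_tmul]
  · rw [counit_ev_one, hk.counit_eq_one]
  · rw [comul_ev_one, hk.comul_eq_tmul_self, TensorProduct.map_tmul]
  · have h := mk_projDual_ev_one k
    rw [hk.comul_eq_tmul_self, TensorProduct.map_tmul, ofTensor_tmul] at h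
    exact h.symm

theorem mk_injective {f g : OpDual K A} {a b : A} (hf : IsGroupLikeElem K f)
    (hg : IsGroupLikeElem K g) (ha : IsGroupLikeElem K a) (hb : IsGroupLikeElem K b)
    (h : inclDual K A f * inclA K A a = inclDual K A g * inclA K A b) : f = g ∧ a = b := by
  have h1 := congr(projDual K A $h)
  have h2 := congr(ev A 1 $h)
  rw [projDual_mk, projDual_mk, ha.counit_eq_one, hb.counit_eq_one, one_smul, one_smul] at h1
  rw [ev_mk, ev_mk, (OpDual.isGroupLikeElem_iff.1 hf).1, (OpDual.isGroupLikeElem_iff.1 hg).1,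
    one_smul, one_smul] at h2
  exact ⟨h1, h2⟩

/-! ### Conjugation by group-like elements of the double. -/

theorem inclA_injective : Function.Injective (inclA K A) := by
  intro a b h
  have h1 : ∀ c : A, ev A 1 (inclA K A c) = c := by
    intro c
    have := ev_mk (K := K) 1 1 c
    simpa [OpDual.one_apply] using this
  rw [← h1 a, h, h1]

/-- For group-like b the twofold coproduct is b ⊗ b ⊗ b and S⁻¹(b) = S(b), so the commutation rule
becomes a conjugation of the argument of f. -/
theorem inclA_mul_inclDual_of_isGroupLikeElem {b : A} (hb : IsGroupLikeElem K b) (f : OpDual K A) :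
    inclA K A b * inclDual K A f = inclDual K A (OpDual.conj b f) * inclA K A b := by
  refine ev_ext fun x => ?_
  have h1 : antipodeInv K A b = antipode K b := by
    conv_lhs => rw [← hb.antipode_antipode]
    simp
  rw [ev_inclA_mul_inclDual, ev_mk, comul₂, LinearMap.comp_apply, hb.comul_eq_tmul_self,
    LinearMap.lTensor_tmul, hb.comul_eq_tmul_self, OpDual.sandM_tmul, OpDual.conj_apply, h1]

/-- A character is invariant under conjugation by the unit b. -/
theorem inclA_mul_inclDual_comm {b : A} (hb : IsGroupLikeElem K b) {γ : OpDual K A}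
    (hγ : IsGroupLikeElem K γ) :
    inclA K A b * inclDual K A γ = inclDual K A γ * inclA K A b := by
  rw [inclA_mul_inclDual_of_isGroupLikeElem hb]
  congr 2
  ext x
  obtain ⟨h1, h2⟩ := OpDual.isGroupLikeElem_iff.1 hγ
  rw [OpDual.conj_apply, h2, h2, mul_left_comm, ← h2, hb.antipode_mul_cancel, h1, mul_one]

theorem inclA_coadjointAction_mul (γ : GroupLike K (OpDual K A)) (y : A) :
    inclA K A (coadjointAction γ y) * inclDual K A γ = inclDual K A γ * inclA K A y := by
  -- As δ is a character, δ(S⁻¹(y₃) x y₁) splits into three factors, and δ ∘ S⁻¹ = δ⁻¹. The lemma is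
  -- the case δ = γ⁻¹, multiplied by γ on both sides.
  have h : ∀ (δ : GroupLike K (OpDual K A)) (y : A), inclA K A y * inclDual K A δ =
      inclDual K A δ * inclA K A (coadjointAction δ⁻¹ y) := by
    intro δ y
    refine ev_ext fun x => ?_
    obtain ⟨h1, h2⟩ := OpDual.isGroupLikeElem_iff.1 δ.2
    rw [ev_inclA_mul_inclDual, ev_mk, coadjointAction, inv_inv, comul₂, LinearMap.comp_apply,
      rightHit, LinearMap.comp_apply, LinearMap.comp_apply]
    generalize comul (R := K) y = t
    induction t with
    | zero => simp
    | add x y hx hy => simp only [map_add, smul_add, hx, hy]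
    | tmul p z =>
      simp only [LinearMap.lTensor_tmul, LinearMap.rTensor_tmul, LinearEquiv.coe_coe,
        TensorProduct.lid_tmul, map_smul, leftHit, LinearMap.comp_apply]
      generalize comul (R := K) z = t
      induction t with
      | zero => simp
      | add x y hx hy => simp only [map_add, TensorProduct.tmul_add, smul_add, hx, hy]
      | tmul q r => simp [h2, smul_smul]; congr 1; ring
  have hγ : inclDual K A γ * inclDual K A ((γ⁻¹ : GroupLike K (OpDual K A)) : OpDual K A) = 1 := by
    rw [← map_mul, ← GroupLike.val_mul, mul_inv_cancel, GroupLike.val_one, map_one]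
  have hγ' : inclDual K A ((γ⁻¹ : GroupLike K (OpDual K A)) : OpDual K A) * inclDual K A γ = 1 := by
    rw [← map_mul, ← GroupLike.val_mul, inv_mul_cancel, GroupLike.val_one, map_one]
  have h3 := congr(inclDual K A γ * $(h γ⁻¹ y) * inclDual K A γ)
  rw [← mul_assoc _ _ (inclA K A _), hγ, one_mul, inv_inv, mul_assoc, mul_assoc, hγ', mul_one] at h3
  exact h3.symm

theorem apply_coadjointAction (γ : GroupLike K (OpDual K A)) (f : OpDual K A) (y : A) :
    f (coadjointAction γ y) =
      ((γ⁻¹ : GroupLike K (OpDual K A)) * (f * (γ : OpDual K A)) : OpDual K A) y := by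
  rw [coadjointAction, apply_leftHit, apply_rightHit]

/-- Conjugation by `γ b` implements `S²` on `D(A)` if and only if it does so on `A`. -/
theorem antipode_antipode_eq_iff (γ : GroupLike K (OpDual K A)) (b : GroupLike K A) :
    (∀ y : DrinfeldDouble K A, antipode K (antipode K y) =
      inclDual K A γ * inclA K A b * y * Ring.inverse (inclDual K A γ * inclA K A b)) ↔
    ∀ y : A, antipode K (antipode K y) = coadjointAction γ (adjointAction K (b : A) y) := by
  have hk := isGroupLikeElem_mk γ.2 b.2
  have hA : ∀ y : A, inclDual K A γ * inclA K A b * inclA K A y =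
      inclA K A (coadjointAction γ (adjointAction K (b : A) y)) *
        (inclDual K A γ * inclA K A b) := by
    intro y
    rw [← mul_assoc, inclA_coadjointAction_mul, adjointAction_of_isGroupLikeElem b.2, mul_assoc,
      mul_assoc, ← map_mul, ← map_mul, mul_assoc, mul_assoc, b.2.antipode_mul_cancel, mul_one]
  simp only [Ring.eq_mul_inverse_iff_mul_eq _ _ _ hk.isUnit]
  constructor
  · intro h y
    have h1 := h (inclA K A y)
    rw [hA, antipode_inclA, antipode_inclA] at h1
    exact inclA_injective (hk.isUnit.mul_right_cancel h1)
  · intro h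
    -- The relation on A° is the transpose of the one on A: S² of A° is f ↦ f ∘ S⁻², and ad*(γ)
    -- transposes to f ↦ γ⁻¹ f γ.
    have hDual : ∀ f : OpDual K A, inclDual K A (antipode K (antipode K f)) *
        (inclDual K A γ * inclA K A b) = inclDual K A γ * inclA K A b * inclDual K A f := by
      intro f
      rw [mul_assoc, inclA_mul_inclDual_of_isGroupLikeElem b.2, ← mul_assoc, ← mul_assoc,
        ← map_mul, ← map_mul]
      congr 2
      have hγ : ((γ⁻¹ : GroupLike K (OpDual K A)) : OpDual K A) * (γ : OpDual K A) = 1 := by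
        rw [← GroupLike.val_mul, inv_mul_cancel, GroupLike.val_one]
      have h1 : antipode K (antipode K f) = (γ : OpDual K A) * OpDual.conj (b : A) f *
          ((γ⁻¹ : GroupLike K (OpDual K A)) : OpDual K A) := by
        ext x
        -- Testing on arguments of the form S²(x) removes S⁻² on the left and lets `h` rewrite the
        -- right.
        obtain ⟨x, rfl⟩ := (InvertibleAntipode.bijective (K := K) (A := A)).2 x
        obtain ⟨x, rfl⟩ := (InvertibleAntipode.bijective (K := K) (A := A)).2 x
        rw [OpDual.antipode_apply, OpDual.antipode_apply, antipodeInv_antipode,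
          antipodeInv_antipode, h, apply_coadjointAction, mul_assoc _ _ (γ : OpDual K A), hγ,
          mul_one, ← mul_assoc, hγ, one_mul, adjointAction_of_isGroupLikeElem b.2,
          OpDual.conj_apply, mul_assoc, b.2.antipode_mul_cancel, mul_one, ← mul_assoc,
          b.2.antipode_mul_cancel, one_mul]
      rw [h1, mul_assoc, hγ, mul_one]
    intro y
    induction y using induction with
    | h0 => simp
    | hadd x y hx hy => simp only [map_add, mul_add, add_mul, hx, hy]
    | hmul f a =>
      rw [antipode_mul_antidistrib, antipode_mul_antidistrib, antipode_inclDual, antipode_inclDual,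
        antipode_inclA, antipode_inclA, mul_assoc, h, ← hA, ← mul_assoc, hDual, mul_assoc]

/-! ### The value of χ, and the classification of balancings. -/

theorem chi_mk (f : OpDual K A) (a : A) : chi (inclDual K A f * inclA K A a) = f a := by
  rw [← ofTensor_tmul]
  simp [chi]

theorem chi_mk_inv (γ : GroupLike K (OpDual K A)) (c : GroupLike K A) :
    chi (inclDual K A γ * inclA K A ((c⁻¹ : GroupLike K A) : A)) =
      ((γ : OpDual K A) (c : A))⁻¹ := by
  rw [chi_mk]
  obtain ⟨h1, h2⟩ := OpDual.isGroupLikeElem_iff.1 γ.2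
  refine eq_inv_of_mul_eq_one_left ?_
  rw [← h2, ← GroupLike.val_mul, inv_mul_cancel, GroupLike.val_one, h1]

theorem nu_mk_inv (γ : GroupLike K (OpDual K A)) (c : GroupLike K A) :
    nu (inclDual K A γ * inclA K A ((c⁻¹ : GroupLike K A) : A)) = (γ : OpDual K A) (c : A) := by
  rw [nu, chi_mk_inv, inv_inv]

theorem mk_sq (γ : GroupLike K (OpDual K A)) (b : GroupLike K A) :
    (inclDual K A γ * inclA K A b) ^ 2 =
      inclDual K A ((γ : OpDual K A) ^ 2) * inclA K A ((b : A) ^ 2) := by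
  rw [map_pow, map_pow]
  exact Commute.mul_pow (inclA_mul_inclDual_comm b.2 γ.2).symm 2

theorem isBalancing_iff {α : OpDual K A} {a : A} (hα : IsModulus K α) (ha : IsComodulus K a)
    (k : DrinfeldDouble K A) :
    IsBalancing (universalR K A) k ↔
      ∃ (rα : GroupLike K (OpDual K A)) (ra : GroupLike K A),
        (rα : OpDual K A) ^ 2 = α ∧ (ra : A) ^ 2 = a ∧
        k = inclDual K A rα * inclA K A ((ra⁻¹ : GroupLike K A) : A) ∧
        ∀ y : A, antipode K (antipode K y) =
          coadjointAction rα (adjointAction K ((ra⁻¹ : GroupLike K A) : A) y) := by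
  constructor
  · rintro ⟨h1, h2, h3⟩
    obtain ⟨γ, b, rfl⟩ := exists_eq_of_isGroupLikeElem h1
    rw [canonicalElement_eq hα ha, mk_sq] at h2
    obtain ⟨h4, h5⟩ := mk_injective hα.isGroupLikeElem γ.2.pow ha.isGroupLikeElem.antipode
      b.2.pow h2
    -- Comparing factors gave b² = S(a) = a⁻¹, so the square root of a is b⁻¹.
    refine ⟨γ, b⁻¹, h4.symm, ?_, by rw [inv_inv], ?_⟩
    · have h6 : (⟨a, ha.isGroupLikeElem⟩ : GroupLike K A)⁻¹ = b ^ 2 := GroupLike.val_injective h5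
      rw [inv_eq_iff_eq_inv, ← inv_pow] at h6
      exact congr(GroupLike.val $h6).symm
    · rw [inv_inv]
      exact (antipode_antipode_eq_iff γ b).1 h3
  · rintro ⟨γ, c, rfl, rfl, rfl, h⟩
    refine ⟨isGroupLikeElem_mk γ.2 (c⁻¹).2, ?_, (antipode_antipode_eq_iff γ c⁻¹).2 h⟩
    rw [canonicalElement_eq hα ha, mk_sq]
    congr 2
    have h6 : (c ^ 2)⁻¹ = c⁻¹ ^ 2 := (inv_pow c 2).symm
    exact congr(GroupLike.val $h6)

end DrinfeldDouble

end

theorem mainTheorem10 {K A : Type*} [Field K] [Ring A] [HopfAlgebra K A] [FiniteDimensional K A]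
    [InvertibleAntipode K A] (α : OpDual K A) (a : A) (hα : IsModulus K α) (ha : IsComodulus K a) :
    (∀ k : DrinfeldDouble K A,
      IsBalancing (DrinfeldDouble.universalR K A) k ↔
        ∃ (rα : GroupLike K (OpDual K A)) (ra : GroupLike K A),
          (rα : OpDual K A) ^ 2 = α ∧ (ra : A) ^ 2 = a ∧
          k = DrinfeldDouble.inclDual K A rα *
            DrinfeldDouble.inclA K A ((ra⁻¹ : GroupLike K A) : A) ∧
          ∀ y : A, HopfAlgebra.antipode K (HopfAlgebra.antipode K y) =
            coadjointAction rα (adjointAction K ((ra⁻¹ : GroupLike K A) : A) y)) ∧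
    (∀ k : DrinfeldDouble K A,
      IsBalancing (DrinfeldDouble.universalR K A) k →
        (∀ (rα : GroupLike K (OpDual K A)) (ra : GroupLike K A),
          k = DrinfeldDouble.inclDual K A rα *
            DrinfeldDouble.inclA K A ((ra⁻¹ : GroupLike K A) : A) →
          (DrinfeldDouble.nu k)⁻¹ = DrinfeldDouble.chi k ∧
            DrinfeldDouble.chi k = ((rα : OpDual K A) (ra : A))⁻¹) ∧
        (∃ n : ℕ, 0 < n ∧ DrinfeldDouble.nu k ^ n = 1) ∧
        DrinfeldDouble.nu k ^ 4 = α a) ∧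
    (∀ k k' : DrinfeldDouble K A,
      IsBalancing (DrinfeldDouble.universalR K A) k →
      IsBalancing (DrinfeldDouble.universalR K A) k' →
        DrinfeldDouble.nu k ^ 2 = DrinfeldDouble.nu k' ^ 2) := by
  refine ⟨DrinfeldDouble.isBalancing_iff hα ha, fun k hk => ⟨?_, ?_⟩, fun k k' hk hk' => ?_⟩
  · rintro γ c rfl
    exact ⟨inv_inv _, DrinfeldDouble.chi_mk_inv γ c⟩
  · obtain ⟨γ, c, rfl, rfl, rfl, -⟩ := (DrinfeldDouble.isBalancing_iff hα ha k).1 hk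
    rw [DrinfeldDouble.nu_mk_inv]
    -- Evaluation at the group-like c is multiplicative on A°, so γⁿ = 1 gives γ(c)ⁿ = ε(c) = 1.
    refine ⟨⟨orderOf γ, orderOf_pos γ, ?_⟩, ?_⟩
    · rw [← OpDual.pow_apply_of_isGroupLikeElem _ c.2, ← GroupLike.val_pow, pow_orderOf_eq_one,
        GroupLike.val_one, OpDual.one_apply, c.2.counit_eq_one]
    · rw [OpDual.pow_apply_of_isGroupLikeElem _ c.2.pow, pow_two (c : A),
        (OpDual.isGroupLikeElem_iff.1 γ.2).2]
      ring
  · obtain ⟨γ, c, h1, h2, rfl, -⟩ := (DrinfeldDouble.isBalancing_iff hα ha k).1 hk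
    obtain ⟨γ', c', h1', h2', rfl, -⟩ := (DrinfeldDouble.isBalancing_iff hα ha k').1 hk'
    -- This permits replacing c' by c in γ'(c')², after which only γ'² = α = γ² matters.
    have key : ∀ (γ : GroupLike K (OpDual K A)) (c : GroupLike K A), (c : A) ^ 2 = a →
        (γ : OpDual K A) a = (γ : OpDual K A) (c : A) ^ 2 := by
      rintro γ c rfl
      rw [pow_two, (OpDual.isGroupLikeElem_iff.1 γ.2).2, ← pow_two]
    rw [DrinfeldDouble.nu_mk_inv, DrinfeldDouble.nu_mk_inv, ← key γ' c' h2', key γ' c h2,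
      ← OpDual.pow_apply_of_isGroupLikeElem _ c.2, ← OpDual.pow_apply_of_isGroupLikeElem _ c.2,
      h1, h1']
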